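/- For a finite simple graph $G=(V,E)$ let $\mathbf{X}_G=\sum_{f}\prod_{v\in V}x_{f(v)}$ be its chromatic symmetric function, the sum being over all proper colorings of $G$ by countably many colors. For a partition $\lambda=(\lambda_1\ge\dots\ge\lambda_\ell)$ of $n$, write $\ell(\lambda)=\ell$, let $m_p(\lambda)$ be the multiplicity of $p$ in $\lambda$, let $St_\lambda$ be the forest of stars with components of orders $\lambda_1,\dots,\lambda_\ell$, and put $\mathfrak{st}_\lambda=\mathbf{X}_{St_\lambda}$. **Theorem.** Let $T$ be a tree of order $n$ and of diameter four. 1. If $T'$ is any finite tree with $\mathbf{X}_{T'}=\mathbf{X}_T$, then $T'\cong T$. 2. There are unique rational coefficients $c_\lambda$ with $\mathbf{X}_T=\sum_{\lambda\vdash n}c_\lambda\,\mathfrak{st}_\lambda$. Let $\lambda_{\mathrm{lead}}$ be the leading partition, that is, the smallest $\lambda\vdash n$ in lexicographic order with $c_\lambda\ne0$. Then $T$ is determined up to isomorphism, among the trees of diameter four, by $\lambda_{\mathrm{lead}}$ and the nonzero coefficients $c_\mu$ indexed by the partitions $\mu\vdash n$ that have no part equal to $1$ and satisfy $\ell(\mu)=\ell(\lambda_{\mathrm{lead}})-1$.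 3. The following algorithm reconstructs $T$, up to isomorphism, from these data. If $1$ is a part of $\lambda_{\mathrm{lead}}$, put $p=1$. Otherwise let $p$ be the first part of $\lambda_{\mathrm{lead}}$ with $N(p)>m_p(\lambda_{\mathrm{lead}})$, where $N(p)=\sum_\mu m_p(\lambda_{\mathrm{lead}}-\mu)\,c_\mu$, the sum is over the partitions $\mu$ of part 2, and $\lambda_{\mathrm{lead}}-\mu$ is the multiset difference of the parts; such a part exists. Remove one copy of $p$ from $\lambda_{\mathrm{lead}}$, take a star of order $p$ and, for every remaining part $q$, a star of order $q$, and add an edge from the center of each of these latter stars to the center of the star of order $p$. -/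

import Mathlib

/-- The chromatic symmetric function of a finite simple graph, as a formal power series in the
countably many commuting variables `x i`, `i : ℕ`: the coefficient of the monomial `x ^ m` is the
number of proper colourings `f` of the graph with `∏ v, x (f v) = x ^ m`. -/
noncomputable def chromSym {V : Type*} [Fintype V] (G : SimpleGraph V) : MvPowerSeries ℕ ℚ :=
  fun m => (Nat.card {f : G.Coloring ℕ // ∑ v, Finsupp.single (f v) 1 = m} : ℚ)

/-- Disjoint blocks whose numbers of vertices are the entries of the list `l`. -/
abbrev BlockVertex (l : List ℕ) : Type := (i : Fin l.length) × Fin (l.get i)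

/-- The star forest with one star for each entry of the list `l`, the entry being the order of the
star. In each block the vertex with index `0` is the center of the star. -/
def starForest (l : List ℕ) : SimpleGraph (BlockVertex l) where
  Adj a b := a.1 = b.1 ∧ Xor (a.2.val = 0) (b.2.val = 0)
  symm := ⟨fun _ _ h => ⟨h.1.symm, h.2.symm⟩⟩
  loopless := ⟨fun _ h => by simp [Xor] at h⟩

/-- The graph obtained from the star forest of `l` by adding, for every star but the first one,
an edge from its center to the center of the first star. -/
def joinedStars (l : List ℕ) : SimpleGraph (BlockVertex l) where
  Adj a b := (starForest l).Adj a b ∨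
    (a.1 ≠ b.1 ∧ a.2.val = 0 ∧ b.2.val = 0 ∧ (a.1.val = 0 ∨ b.1.val = 0))
  symm := ⟨fun _ _ h => h.imp (fun h => h.symm)
    fun h => ⟨h.1.symm, h.2.2.1, h.2.1, h.2.2.2.symm⟩⟩
  loopless := ⟨fun a h => h.elim (fun h => (starForest l).loopless.irrefl a h) fun h => h.1 rfl⟩

/-- The parts of a partition in weakly decreasing order. -/
def partList {n : ℕ} (lam : n.Partition) : List ℕ := lam.parts.sort (· ≥ ·)

/-- The element of the star basis indexed by `lam`. -/
noncomputable def starBasis {n : ℕ} (lam : n.Partition) : MvPowerSeries ℕ ℚ :=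
  chromSym (starForest (partList lam))

/-- The function `c` gives coefficients of the chromatic symmetric function of `G` in the star
basis. -/
def IsStarExpansion {V : Type*} [Fintype V] (G : SimpleGraph V) {n : ℕ}
    (c : n.Partition → ℚ) : Prop :=
  chromSym G = ∑ lam, c lam • starBasis lam

/-- The partition `lam` is the smallest one, in lexicographic order, with `c lam ≠ 0`. (The order
on `List ℕ` is the lexicographic one.) -/
def IsLeadingPartition {n : ℕ} (c : n.Partition → ℚ) (lam : n.Partition) : Prop :=
  c lam ≠ 0 ∧ ∀ mu : n.Partition, c mu ≠ 0 → partList lam ≤ partList mu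

/-- The partitions without parts equal to `1` whose length is one less than that of `lam`. -/
abbrev MergeIndex {n : ℕ} (lam : n.Partition) : Type :=
  {mu : n.Partition // 1 ∉ mu.parts ∧ mu.parts.card + 1 = lam.parts.card}

/-- The number `N(p)`, that is, the sum of `m_p(lam - mu) * d mu`, where `lam - mu` is the
multiset difference and `m_p` is the multiplicity of `p`. -/
def partWeight {n : ℕ} (lam : n.Partition) (d : MergeIndex lam → ℚ) (p : ℕ) : ℚ :=
  ∑ mu : MergeIndex lam, ((lam.parts - mu.1.parts).count p : ℚ) * d mu

/-- The order of the central star: `1` if `1` is a part of `lam`, and otherwise the first part `p`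
of `lam` with `N(p) > m_p(lam)`. (The value `0` stands for failure.) -/
def centralOrder {n : ℕ} (lam : n.Partition) (d : MergeIndex lam → ℚ) : ℕ :=
  if 1 ∈ lam.parts then 1
  else ((partList lam).find? fun p => decide ((lam.parts.count p : ℚ) < partWeight lam d p)).getD 0

/-- The orders of the stars to be joined, that of the central star first. -/
def starOrders {n : ℕ} (lam : n.Partition) (d : MergeIndex lam → ℚ) : List ℕ :=
  centralOrder lam d :: (partList lam).erase (centralOrder lam d)

/-- The reconstruction algorithm: from `lam` and the coefficients `d mu`, find the order of
the central star, and join its center to the centers of stars whose orders are the remaining parts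
of `lam`. -/
def reconstructTree {n : ℕ} (lam : n.Partition) (d : MergeIndex lam → ℚ) :
    SimpleGraph (BlockVertex (starOrders lam d)) :=
  joinedStars (starOrders lam d)

/-! A tree of diameter four has a center `v`. With its leaf neighbours `v` forms a star of order `p
≥ 1`, and every other neighbour `u_i` forms with its leaves a star of order `q_i ≥ 2`. There are at
least two such `u_i`. So the tree is `joinedStars (p :: q)`, and the task is to read off `p` and the
multiset of the `q_i`.

Write `P` for the sum of the variables and `st_m = ∑_c x_c (P - x_c)^(m-1)`. Once the colour `c` of
`v` is fixed, the star at `v` contributes `x_c (P - x_c)^(p-1)` and the star at `u_i` contributes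
`st_(q_i) - x_c (P - x_c)^(q_i-1)`. Expanding the product over the set `S` of factors that take the
second term, and replacing each `-x_c` by `(P - x_c) - P`, gives the star expansion: `S` and `j ≤
|S|` contribute `(-1)^j (|S| choose j)` at the partition that merges `p` with the `q_i`, `i ∈ S`,
and splits off `j` ones (`colorSum_joinedStars_expansion`, `joinCoeff`).

Merging creates a part larger than all the parts it replaces, so `(p, q)` is lexicographically
smallest. The only coincidence is `p = |S| = j = 1`, and it leaves the coefficient `1 - #q ≠ 0`
(`mergeParts_trichotomy`). One part fewer and no ones means `|S| = 1` and `j = 0`, so these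
coefficients record the pairs `{p, q_i}`. Counting parts in them gives `N(p) = #q + m_p(q)` and
`N(r) = m_r(q)` for `r ≠ p`, which singles out `p` (`partWeight_joinCoeff`).

Two more facts are needed. The star products are linearly independent
(`sum_partition_eq_zero_of_colorSums`). Among trees, the chromatic symmetric function determines the
diameter: the second moment of the size of a colour class, for varying numbers of colours, gives the
distribution of distances (`distPolynomial_eq_of_chromSym_eq`). -/

/-! ### Weighted sums over proper colourings -/

open Classical in
/-- The sum over the proper colourings `f : V → K` of the product of the weights `φ v (f v)`. -/
noncomputable def weightedColorings {V K R : Type*} [Fintype V] [Fintype K] [CommSemiring R]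
    (G : SimpleGraph V) (φ : V → K → R) : R :=
  ∑ f : V → K, if ∀ a b, G.Adj a b → f a ≠ f b then ∏ v, φ v (f v) else 0

/-- The chromatic symmetric function in finitely many variables, evaluated at `x`. -/
noncomputable def colorSum {V K R : Type*} [Fintype V] [Fintype K] [CommSemiring R]
    (G : SimpleGraph V) (x : K → R) : R := weightedColorings G fun _ => x

theorem weightedColorings_congr {V W K R : Type*} [Fintype V] [Fintype W] [Fintype K]
    [CommSemiring R] {G : SimpleGraph V} {H : SimpleGraph W} (e : G ≃g H) (φ : W → K → R) :
    weightedColorings G (fun v => φ (e v)) = weightedColorings H φ := by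
  classical
  unfold weightedColorings
  refine Fintype.sum_equiv (Equiv.arrowCongr e.toEquiv (Equiv.refl K)) _ _ fun f => ?_
  have h1 : (∀ a b, G.Adj a b → f a ≠ f b) ↔ ∀ a b, H.Adj a b →
      (Equiv.arrowCongr e.toEquiv (Equiv.refl K)) f a ≠
        (Equiv.arrowCongr e.toEquiv (Equiv.refl K)) f b := by
    constructor
    · intro h a b hab
      exact h _ _ (e.symm.map_adj_iff.2 hab)
    · intro h a b hab
      have := h (e a) (e b) (e.map_adj_iff.2 hab)
      change f (e.symm (e a)) ≠ f (e.symm (e b)) at this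
      rwa [RelIso.symm_apply_apply, RelIso.symm_apply_apply] at this
  have h2 : ∏ v, φ (e v) (f v) = ∏ v, φ v ((Equiv.arrowCongr e.toEquiv (Equiv.refl K)) f v) := by
    refine Fintype.prod_equiv e.toEquiv _ _ fun v => ?_
    change φ (e v) (f v) = φ (e v) (f (e.symm (e v)))
    rw [RelIso.symm_apply_apply]
  simp only [h1, h2]

theorem colorSum_congr {V W K R : Type*} [Fintype V] [Fintype W] [Fintype K]
    [CommSemiring R] {G : SimpleGraph V} {H : SimpleGraph W} (e : G ≃g H) (x : K → R) :
    colorSum G x = colorSum H x := weightedColorings_congr e fun _ => x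

theorem colorSum_comp_equiv {V K L R : Type*} [Fintype V] [Fintype K] [Fintype L]
    [CommSemiring R] (G : SimpleGraph V) (e : K ≃ L) (x : L → R) :
    colorSum G (x ∘ e) = colorSum G x := by
  classical
  unfold colorSum weightedColorings
  refine Fintype.sum_equiv (Equiv.arrowCongr (Equiv.refl V) e) _ _ fun f => ?_
  simp

theorem map_colorSum {V K R S : Type*} [Fintype V] [Fintype K] [CommSemiring R] [CommSemiring S]
    (G : SimpleGraph V) (x : K → R) (h : R →+* S) : h (colorSum G x) = colorSum G (h ∘ x) := by
  unfold colorSum weightedColorings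
  simp only [map_sum, apply_ite h, map_prod, map_zero, Function.comp]

theorem colorSum_mul_left {V K R : Type*} [Fintype V] [Fintype K] [CommSemiring R]
    (G : SimpleGraph V) (t : R) (x : K → R) :
    colorSum G (fun i => t * x i) = t ^ Fintype.card V * colorSum G x := by
  unfold colorSum weightedColorings
  simp only [Finset.mul_sum, mul_ite, mul_zero, Finset.prod_mul_distrib, Finset.prod_const,
    Finset.card_univ]

/-! ### From power series to evaluations in finitely many colours -/

/-- The chromatic symmetric function in the first `N` variables. -/
noncomputable def chromPoly {V : Type*} [Fintype V] (G : SimpleGraph V) (N : ℕ) :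
    MvPolynomial ℕ ℚ := colorSum G fun i : Fin N => MvPolynomial.X (i : ℕ)

theorem coeff_chromPoly {V : Type*} [Fintype V] (G : SimpleGraph V) (N : ℕ) (m : ℕ →₀ ℕ) :
    (chromPoly G N).coeff m = if m.support ⊆ Finset.range N then chromSym G m else 0 := by
  classical
  have key : (chromPoly G N).coeff m = (Nat.card {f : V → Fin N //
      (∀ a b, G.Adj a b → f a ≠ f b) ∧ ∑ v, Finsupp.single ((f v : Fin N) : ℕ) 1 = m} : ℚ) := by
    have hX (f : V → Fin N) : ∏ v, (MvPolynomial.X ((f v : Fin N) : ℕ) : MvPolynomial ℕ ℚ) =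
        MvPolynomial.monomial (∑ v, Finsupp.single ((f v : Fin N) : ℕ) 1) 1 := by
      rw [MvPolynomial.monomial_sum_one]
      rfl
    unfold chromPoly colorSum weightedColorings
    simp only [MvPolynomial.coeff_sum, apply_ite (MvPolynomial.coeff m), hX,
      MvPolynomial.coeff_monomial, MvPolynomial.coeff_zero]
    rw [Nat.card_eq_fintype_card, Fintype.card_subtype, Finset.card_filter]
    push_cast
    refine Finset.sum_congr rfl fun f _ => ?_
    split_ifs <;> simp_all
  have hmem {f : V → ℕ} (h : ∑ v, Finsupp.single (f v) 1 = m) (v : V) : f v ∈ m.support := by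
    rw [← h, Finsupp.mem_support_iff, Finsupp.finsetSum_apply]
    have : Finsupp.single (f v) 1 (f v) ≤ ∑ w, Finsupp.single (f w) 1 (f v) :=
      Finset.single_le_sum (f := fun w => Finsupp.single (f w) 1 (f v))
        (fun _ _ => Nat.zero_le _) (Finset.mem_univ v)
    simp only [Finsupp.single_eq_same] at this
    omega
  rw [key]
  split_ifs with hm
  · unfold chromSym
    congr 1
    refine Nat.card_congr (Equiv.ofBijective (fun f =>
      ⟨SimpleGraph.Coloring.mk (fun v => ((f.1 v : Fin N) : ℕ))
        fun {a b} hab h => f.2.1 a b hab (Fin.ext h), f.2.2⟩) ⟨?_, ?_⟩)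
    · intro f g h
      apply Subtype.ext
      funext v
      have := congrArg (fun F => F.1 v) h
      exact Fin.ext this
    · rintro ⟨g, hg⟩
      refine ⟨⟨fun v => ⟨g v, Finset.mem_range.1 (hm (hmem hg v))⟩, ?_, hg⟩, ?_⟩
      · intro a b hab h
        exact g.valid hab (congrArg Fin.val h)
      · apply Subtype.ext
        ext v
        rfl
  · rw [Nat.cast_eq_zero, Nat.card_eq_zero]
    refine Or.inl ⟨fun f => hm fun i hi => ?_⟩
    have hi' := f.2.2
    rw [← hi', Finsupp.mem_support_iff, Finsupp.finsetSum_apply] at hi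
    obtain ⟨v, -, hv⟩ := Finset.exists_ne_zero_of_sum_ne_zero hi
    rw [Finsupp.single_apply] at hv
    have : ((f.1 v : Fin N) : ℕ) = i := by
      by_contra h
      simp [h] at hv
    rw [← this]
    simp

theorem chromSym_eq_sum_iff {V ι : Type*} [Fintype V] [Fintype ι] (G : SimpleGraph V)
    {U : ι → Type*} [∀ i, Fintype (U i)] (H : ∀ i, SimpleGraph (U i)) (c : ι → ℚ) :
    chromSym G = ∑ i, c i • chromSym (H i) ↔
      ∀ N, chromPoly G N = ∑ i, c i • chromPoly (H i) N := by
  have hsum (m : ℕ →₀ ℕ) : (∑ i, c i • chromSym (H i) : MvPowerSeries ℕ ℚ) m =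
      ∑ i, c i * chromSym (H i) m := by
    have : MvPowerSeries.coeff m (∑ i, c i • chromSym (H i)) =
        ∑ i, c i * MvPowerSeries.coeff m (chromSym (H i)) := by
      simp only [map_sum, map_smul, smul_eq_mul]
    exact this
  constructor
  · intro h N
    ext m
    simp only [MvPolynomial.coeff_sum, MvPolynomial.coeff_smul, coeff_chromPoly]
    split_ifs
    · rw [h, hsum]; rfl
    · simp
  · intro h
    funext m
    rw [hsum]
    obtain ⟨N, hN⟩ := m.support.exists_nat_subset_range
    have := congrArg (MvPolynomial.coeff m) (h N)
    simpa only [MvPolynomial.coeff_sum, MvPolynomial.coeff_smul, coeff_chromPoly, if_pos hN,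
      smul_eq_mul] using this

/-- The weights of the colours as a sequence, continued by zeros. -/
noncomputable def weightSeq {K R : Type*} [Fintype K] [CommSemiring R] (x : K → R) (i : ℕ) : R :=
  if h : i < Fintype.card K then x ((Fintype.equivFin K).symm ⟨i, h⟩) else 0

theorem colorSum_eq_aeval {V K R : Type*} [Fintype V] [Fintype K] [CommSemiring R] [Algebra ℚ R]
    (G : SimpleGraph V) (x : K → R) :
    colorSum G x = MvPolynomial.aeval (weightSeq x) (chromPoly G (Fintype.card K)) := by
  have := map_colorSum G (fun i : Fin (Fintype.card K) => (MvPolynomial.X (i : ℕ) :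
    MvPolynomial ℕ ℚ)) (MvPolynomial.aeval (R := ℚ) (weightSeq x) :
      MvPolynomial ℕ ℚ →ₐ[ℚ] R).toRingHom
  refine Eq.trans ?_ this.symm
  rw [← colorSum_comp_equiv G (Fintype.equivFin K).symm x]
  congr 1
  funext i
  simp [weightSeq]

/-- A power series cannot be evaluated freely, but its truncations are polynomials. Hence any linear
relation between chromatic symmetric functions survives every finite specialization of the
variables. -/
theorem colorSum_eq_sum {V ι K R : Type*} [Fintype V] [Fintype ι] [Fintype K] [CommSemiring R]
    [Algebra ℚ R] {G : SimpleGraph V} {U : ι → Type*} [∀ i, Fintype (U i)]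
    {H : ∀ i, SimpleGraph (U i)} {c : ι → ℚ} (h : chromSym G = ∑ i, c i • chromSym (H i))
    (x : K → R) : colorSum G x = ∑ i, c i • colorSum (H i) x := by
  simp only [colorSum_eq_aeval, (chromSym_eq_sum_iff G H c).1 h, map_sum, map_smul]

theorem colorSum_eq_of_chromSym_eq {V W K R : Type*} [Fintype V] [Fintype W] [Fintype K]
    [CommSemiring R] [Algebra ℚ R] {G : SimpleGraph V} {H : SimpleGraph W}
    (h : chromSym G = chromSym H) (x : K → R) : colorSum G x = colorSum H x := by
  simpa using colorSum_eq_sum (ι := Unit) (U := fun _ => W) (H := fun _ => H) (c := fun _ => 1)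
    (by simpa using h) x

/-! ### Colour sums of star forests and of joined stars -/

/-- The chromatic symmetric function of the star of order `m`, evaluated at `x`. -/
noncomputable def starSum {K R : Type*} [Fintype K] [CommRing R] (x : K → R) (m : ℕ) : R :=
  ∑ c, x c * (∑ d, x d - x c) ^ (m - 1)

theorem starSum_one {K R : Type*} [Fintype K] [CommRing R] (x : K → R) :
    starSum x 1 = ∑ c, x c := by simp [starSum]

theorem sum_starBlock {K R : Type*} [Fintype K] [DecidableEq K] [CommRing R] (x h : K → R) {m : ℕ}
    (hm : 0 < m) :
    (∑ f : Fin m → K, if ∀ j : Fin m, j.val ≠ 0 → f j ≠ f ⟨0, hm⟩ then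
      h (f ⟨0, hm⟩) * ∏ j, x (f j) else 0) =
    ∑ c, h c * (x c * (∑ d, x d - x c) ^ (m - 1)) := by
  obtain ⟨m, rfl⟩ : ∃ k, m = k + 1 := ⟨m - 1, (Nat.sub_add_cancel hm).symm⟩
  rw [← (Fin.consEquiv fun _ : Fin (m + 1) => K).sum_comp, Fintype.sum_prod_type]
  refine Finset.sum_congr rfl fun c _ => ?_
  have hc : ∑ d, x d - x c = ∑ d, if d ≠ c then x d else 0 := by
    rw [sub_eq_iff_eq_add, ← Finset.sum_filter, Finset.filter_ne', ← Finset.sum_erase_add _ _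
      (Finset.mem_univ c)]
  have hpow : (∑ d, if d ≠ c then x d else 0) ^ m =
      ∑ f : Fin m → K, ∏ j, if f j ≠ c then x (f j) else 0 := by
    have := Finset.prod_univ_sum (fun _ : Fin m => Finset.univ)
      (fun _ d => if d ≠ c then x d else 0)
    rwa [Fintype.piFinset_univ, Finset.prod_const, Finset.card_univ, Fintype.card_fin] at this
  rw [hc, Nat.add_sub_cancel, hpow, Finset.mul_sum, Finset.mul_sum]
  refine Finset.sum_congr rfl fun f _ => ?_
  have h0 : (Fin.consEquiv (fun _ : Fin (m + 1) => K)) (c, f) ⟨0, hm⟩ = c := rfl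
  have h1 (j : Fin m) : (Fin.consEquiv (fun _ : Fin (m + 1) => K)) (c, f) j.succ = f j := rfl
  have h2 : (∀ j : Fin (m + 1), j.val ≠ 0 →
      (Fin.consEquiv (fun _ : Fin (m + 1) => K)) (c, f) j ≠ c) ↔ ∀ j, f j ≠ c := by
    rw [Fin.forall_fin_succ]
    simp only [h1]
    simp
  rw [h0, Finset.prod_ite_zero, Fin.prod_univ_succ]
  simp only [h1, h2, Finset.mem_univ, true_implies]
  split_ifs
  · rfl
  · simp

/-- Blocks are coloured independently, and within a block the leaves independently avoid the colour
of the center. The weights `h` on the centers serve to encode the edges between centers of joined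
stars. -/
theorem weightedColorings_starForest {K R : Type*} [Fintype K] [CommRing R] (l : List ℕ)
    (hl : ∀ m ∈ l, 0 < m) (x : K → R) (h : Fin l.length → K → R) :
    weightedColorings (starForest l) (fun a c => x c * if a.2.val = 0 then h a.1 c else 1) =
      ∏ i, ∑ c, h i c * (x c * (∑ d, x d - x c) ^ (l.get i - 1)) := by
  classical
  have hpos (i : Fin l.length) : 0 < l.get i := hl _ (l.get_mem i)
  have hblock : ∏ i, ∑ c, h i c * (x c * (∑ d, x d - x c) ^ (l.get i - 1)) =
      ∏ i, ∑ f : Fin (l.get i) → K, if ∀ j : Fin (l.get i), j.val ≠ 0 → f j ≠ f ⟨0, hpos i⟩ then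
        h i (f ⟨0, hpos i⟩) * ∏ j, x (f j) else 0 :=
    Finset.prod_congr rfl fun i _ => (sum_starBlock x (h i) (hpos i)).symm
  rw [hblock, Finset.prod_univ_sum, Fintype.piFinset_univ]
  unfold weightedColorings
  rw [← (Equiv.piCurry fun (i : Fin l.length) (_ : Fin (l.get i)) => K).sum_comp]
  refine Finset.sum_congr (by ext; simp) fun f _ => ?_
  rw [Finset.prod_ite_zero]
  have h1 : (∀ a b, (starForest l).Adj a b → f a ≠ f b) ↔ ∀ i ∈ Finset.univ, ∀ j : Fin (l.get i),
      j.val ≠ 0 → (Equiv.piCurry fun (i : Fin l.length) (_ : Fin (l.get i)) => K) f i j ≠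
      (Equiv.piCurry fun (i : Fin l.length) (_ : Fin (l.get i)) => K) f i ⟨0, hpos i⟩ := by
    simp only [Equiv.piCurry_apply, Sigma.curry]
    constructor
    · intro hf i _ j hj
      exact hf _ _ ⟨rfl, Or.inr ⟨rfl, hj⟩⟩
    · rintro hf ⟨i, j⟩ ⟨i', j'⟩ ⟨rfl, hx⟩
      change Xor (j.val = 0) (j'.val = 0) at hx
      rcases hx with ⟨hj, hj'⟩ | ⟨hj', hj⟩
      · have : j = ⟨0, hpos i⟩ := Fin.ext hj
        subst this
        exact (hf i (Finset.mem_univ _) j' hj').symm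
      · have : j' = ⟨0, hpos i⟩ := Fin.ext hj'
        subst this
        exact hf i (Finset.mem_univ _) j hj
  rw [if_congr h1 rfl rfl]
  congr 1
  rw [Fintype.prod_sigma]
  refine Finset.prod_congr rfl fun i _ => ?_
  rw [Finset.prod_mul_distrib, mul_comm]
  congr 1
  rw [Fintype.prod_eq_single ⟨0, hpos i⟩]
  · simp [Sigma.curry]
  · intro j hj
    rw [if_neg fun h => hj (Fin.ext h)]

theorem colorSum_starForest {K R : Type*} [Fintype K] [CommRing R] (l : List ℕ)
    (hl : ∀ m ∈ l, 0 < m) (x : K → R) :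
    colorSum (starForest l) x = (l.map (starSum x)).prod := by
  have := weightedColorings_starForest l hl x fun _ _ => 1
  simp only [ite_self, mul_one, one_mul] at this
  rw [colorSum, this, ← Fin.prod_univ_fun_getElem]
  rfl

theorem colorSum_joinedStars {K R : Type*} [Fintype K] [CommRing R] (p : ℕ) (l : List ℕ)
    (hp : 0 < p) (hl : ∀ m ∈ l, 0 < m) (x : K → R) :
    colorSum (joinedStars (p :: l)) x = ∑ c, x c * (∑ d, x d - x c) ^ (p - 1) *
      ∏ i : Fin l.length, (starSum x (l.get i) - x c * (∑ d, x d - x c) ^ (l.get i - 1)) := by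
  classical
  have hl' : ∀ m ∈ p :: l, 0 < m := by simpa using ⟨hp, hl⟩
  -- Indicator weights: the center of the first star must get colour `c`, and all other centers must
  -- avoid `c`. Summed over `c`, this is the effect of the joining edges.
  let h (c : K) (i : Fin (p :: l).length) (d : K) : R :=
    if i = 0 then (if d = c then 1 else 0) else (if d = c then 0 else 1)
  have key : colorSum (joinedStars (p :: l)) x = ∑ c, weightedColorings (starForest (p :: l))
      (fun a d => x d * if a.2.val = 0 then h c a.1 d else 1) := by
    unfold colorSum weightedColorings
    rw [Finset.sum_comm]
    refine Finset.sum_congr rfl fun f _ => ?_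
    let o : BlockVertex (p :: l) := ⟨0, ⟨0, hp⟩⟩
    simp only [Finset.prod_mul_distrib]
    by_cases hf : ∀ a b, (starForest (p :: l)).Adj a b → f a ≠ f b
    · simp only [if_pos hf]
      rw [Fintype.sum_eq_single (f o)]
      · have : (∀ a b, (joinedStars (p :: l)).Adj a b → f a ≠ f b) ↔
            ∀ a ∈ Finset.univ, a.2.val = 0 → a.1 ≠ 0 → f a ≠ f o := by
          constructor
          · intro hj a _ h0 h1
            exact hj _ _ (Or.inr ⟨h1, h0, rfl, Or.inr rfl⟩)
          · rintro hj a b (hab | ⟨hab, ha, hb, h0 | h0⟩)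
            · exact hf a b hab
            · have ha1 : a.1 = 0 := Fin.ext h0
              have : a = o := by
                obtain ⟨i, j⟩ := a
                obtain rfl : i = 0 := ha1
                obtain rfl : j = ⟨0, hp⟩ := Fin.ext ha
                rfl
              rw [this]
              exact (hj b (Finset.mem_univ _) hb fun h => hab (ha1.trans h.symm)).symm
            · have hb1 : b.1 = 0 := Fin.ext h0
              have : b = o := by
                obtain ⟨i, j⟩ := b
                obtain rfl : i = 0 := hb1
                obtain rfl : j = ⟨0, hp⟩ := Fin.ext hb
                rfl
              rw [this]
              exact hj a (Finset.mem_univ _) ha fun h => hab (h.trans hb1.symm)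
        have h2 : (∏ a : BlockVertex (p :: l), if a.2.val = 0 then h (f o) a.1 (f a) else 1) =
            ∏ a : BlockVertex (p :: l),
              if (a.2.val = 0 → a.1 ≠ 0 → f a ≠ f o) then 1 else 0 := by
          refine Finset.prod_congr rfl fun a _ => ?_
          obtain ⟨i, j⟩ := a
          by_cases hj : j.val = 0
          · by_cases hi : i = 0
            · subst hi
              obtain rfl : j = ⟨0, hp⟩ := Fin.ext hj
              simp [h, o]
            · simp [h, hi, hj]
          · simp [hj]
        rw [h2, Finset.prod_ite_zero, if_congr this rfl rfl]
        simp
      · intro c hc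
        refine mul_eq_zero_of_right _ (Finset.prod_eq_zero (Finset.mem_univ o) ?_)
        have : ¬ f ⟨0, ⟨0, hp⟩⟩ = c := hc.symm
        simp only [h, o, if_true]
        exact if_neg this
    · simp only [if_neg hf, Finset.sum_const_zero]
      rw [if_neg fun hj => hf fun a b hab => hj a b (Or.inl hab)]
  rw [key]
  refine Finset.sum_congr rfl fun c _ => ?_
  rw [weightedColorings_starForest _ hl']
  change ∏ i : Fin (l.length + 1), _ = _
  rw [Fin.prod_univ_succ]
  congr 1
  · simp [h]
  · refine Finset.prod_congr rfl fun i _ => ?_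
    rw [eq_sub_iff_add_eq, starSum]
    rw [← Finset.sum_erase_add (a := c) Finset.univ
      (fun c => x c * (∑ d, x d - x c) ^ (l.get i - 1)) (Finset.mem_univ c)]
    congr 1
    rw [← Finset.sum_erase_add _ _ (Finset.mem_univ c)]
    simp only [h, Fin.succ_ne_zero, if_false, if_true, zero_mul, add_zero]
    refine Finset.sum_congr rfl fun d hd => ?_
    rw [if_neg (Finset.ne_of_mem_erase hd), one_mul]
    rfl

theorem colorSum_joinedStars_expansion {K R : Type*} [Fintype K] [CommRing R] (p : ℕ) (l : List ℕ)
    (hp : 0 < p) (hl : ∀ m ∈ l, 0 < m) (x : K → R) :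
    colorSum (joinedStars (p :: l)) x = ∑ S : Finset (Fin l.length),
      ∑ j ∈ Finset.range (S.card + 1), (-1) ^ j * (S.card.choose j : R) *
        (starSum x (p + ∑ i ∈ S, l.get i - j) * starSum x 1 ^ j *
          ∏ i ∈ Sᶜ, starSum x (l.get i)) := by
  classical
  have hpos (i : Fin l.length) : 0 < l.get i := hl _ (l.get_mem i)
  rw [colorSum_joinedStars p l hp hl]
  simp only [sub_eq_neg_add (starSum x _), Finset.prod_add, Finset.mul_sum]
  rw [Finset.sum_comm, Finset.powerset_univ]
  refine Finset.sum_congr rfl fun S _ => ?_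
  have hS : ∑ i ∈ S, (l.get i - 1) + S.card = ∑ i ∈ S, l.get i := by
    rw [Finset.card_eq_sum_ones, ← Finset.sum_add_distrib]
    exact Finset.sum_congr rfl fun i _ => Nat.sub_add_cancel (hpos i)
  -- Each of the `|S|` factors `-x c` is written as `(P - x c) - P`, where `P = starSum x 1`, and
  -- their product is expanded by the binomial theorem. This leaves powers of `P - x c`, which merge
  -- with the star at the center.
  have h1 (c : K) : ∏ i ∈ S, -(x c * (∑ d, x d - x c) ^ (l.get i - 1)) =
      ∑ j ∈ Finset.range (S.card + 1), (-1) ^ j * (S.card.choose j : R) * starSum x 1 ^ j *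
        (∑ d, x d - x c) ^ (∑ i ∈ S, l.get i - j) := by
    have : ∏ i ∈ S, -(x c * (∑ d, x d - x c) ^ (l.get i - 1)) =
        (-(∑ d, x d) + (∑ d, x d - x c)) ^ S.card *
          (∑ d, x d - x c) ^ (∑ i ∈ S, (l.get i - 1)) := by
      rw [← Finset.prod_pow_eq_pow_sum, ← Finset.prod_const, ← Finset.prod_mul_distrib]
      refine Finset.prod_congr rfl fun i _ => ?_
      ring
    rw [this, add_pow, Finset.sum_mul]
    refine Finset.sum_congr rfl fun j hj => ?_
    have hj' : j ≤ S.card := Nat.lt_succ_iff.1 (Finset.mem_range.1 hj)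
    have : ∑ i ∈ S, l.get i - j = (S.card - j) + ∑ i ∈ S, (l.get i - 1) := by omega
    rw [this, pow_add, starSum_one, neg_pow (∑ d, x d) j]
    ring
  rw [← Finset.compl_eq_univ_sdiff]
  simp only [h1, Finset.mul_sum, Finset.sum_mul]
  rw [Finset.sum_comm]
  refine Finset.sum_congr rfl fun j hj => ?_
  have hj' : j ≤ S.card := Nat.lt_succ_iff.1 (Finset.mem_range.1 hj)
  rw [starSum.eq_1 x (p + ∑ i ∈ S, l.get i - j), Finset.sum_mul, Finset.sum_mul, Finset.mul_sum]
  refine Finset.sum_congr rfl fun c _ => ?_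
  have : p + ∑ i ∈ S, l.get i - j - 1 = (p - 1) + (∑ i ∈ S, l.get i - j) := by omega
  rw [this, pow_add]
  ring

/-! ### Linear independence of the star basis -/

/-- With `k i` colours of weight `i + 1`, the left side is the star sum of order `j + 1`, provided
that the total weight is `t 1`. The equation for `j = 0` says just that, so the system is consistent
with its own nodes, and it is a Vandermonde system after rescaling. -/
theorem exists_vandermonde_solution (n : ℕ) (t : ℕ → ℚ) :
    ∃ k : Fin n → ℚ, ∀ j < n,
      ∑ i, k i * ((i.val + 1 : ℚ) * (t 1 - (i.val + 1 : ℚ)) ^ j) = t (j + 1) := by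
  let v : Fin n → ℚ := fun i => t 1 - (i.val + 1 : ℚ)
  have hv : Function.Injective v := by
    intro i j hij
    have : (i.val : ℚ) = j.val := by simpa [v] using hij
    exact Fin.ext (by exact_mod_cast this)
  have hu : IsUnit (Matrix.vandermonde v).transpose := by
    rw [Matrix.isUnit_iff_isUnit_det, Matrix.det_transpose]
    exact (Matrix.det_vandermonde_ne_zero_iff.2 hv).isUnit
  obtain ⟨k, hk⟩ := Matrix.mulVec_surjective_iff_isUnit.2 hu fun j => t (j.val + 1)
  refine ⟨fun i => k i / (i.val + 1), fun j hj => ?_⟩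
  have := congrFun hk ⟨j, hj⟩
  simp only [Matrix.mulVec, dotProduct, Matrix.transpose_apply, Matrix.vandermonde_apply] at this
  rw [← this]
  refine Finset.sum_congr rfl fun i _ => ?_
  have : (i.val + 1 : ℚ) ≠ 0 := by positivity
  field_simp
  rfl

theorem MvPolynomial.prod_map_X {σ R : Type*} [DecidableEq σ] [CommSemiring R]
    (s : Multiset σ) :
    (s.map (MvPolynomial.X : σ → MvPolynomial σ R)).prod =
      MvPolynomial.monomial (Multiset.toFinsupp s) 1 := by
  induction s using Multiset.induction with
  | empty => simp
  | cons a s ih =>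
    rw [Multiset.map_cons, Multiset.prod_cons, ih, ← Multiset.singleton_add, map_add,
      Multiset.toFinsupp_singleton, MvPolynomial.X, MvPolynomial.monomial_mul, one_mul]

/-- Distinct partitions give distinct monomials, and a polynomial over `ℚ` that vanishes at all
points is zero. -/
theorem eq_zero_of_sum_prod_eq_zero {n : ℕ} (d : n.Partition → ℚ)
    (h : ∀ t : ℕ → ℚ, ∑ lam, d lam * (lam.parts.map t).prod = 0) : d = 0 := by
  have hP : ∑ lam : n.Partition, MvPolynomial.C (d lam) * (lam.parts.map MvPolynomial.X).prod =
      (0 : MvPolynomial ℕ ℚ) := by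
    refine MvPolynomial.funext fun t => ?_
    rw [map_zero, ← h t, map_sum]
    refine Finset.sum_congr rfl fun lam _ => ?_
    rw [map_mul, MvPolynomial.eval_C, map_multiset_prod, Multiset.map_map]
    congr 3
    funext i
    simp
  funext mu
  have := congrArg (MvPolynomial.coeff (Multiset.toFinsupp mu.parts)) hP
  rw [MvPolynomial.coeff_sum] at this
  simp only [MvPolynomial.prod_map_X, MvPolynomial.coeff_C_mul, MvPolynomial.coeff_monomial,
    MvPolynomial.coeff_zero] at this
  rw [Fintype.sum_eq_single mu] at this
  · simpa using this
  · intro lam hlam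
    rw [if_neg fun hh => hlam (Nat.Partition.ext (Multiset.toFinsupp.injective hh)), mul_zero]

/-- The star sums of orders `1, …, n` can be given arbitrary values `t` if the multiplicities of the
weights `1, …, n` may be rational. The relation is polynomial in these multiplicities, so it extends
from natural to rational ones. -/
theorem sum_partition_eq_zero_of_colorSums {n : ℕ} (d : n.Partition → ℚ)
    (h : ∀ {K : Type} [Fintype K] (x : K → ℚ),
      ∑ lam, d lam * (lam.parts.map (starSum x)).prod = 0) : d = 0 := by
  refine eq_zero_of_sum_prod_eq_zero d fun t => ?_
  let s : MvPolynomial (Fin n) ℚ := ∑ i : Fin n, MvPolynomial.X i * MvPolynomial.C (i.val + 1 : ℚ)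
  let g (m : ℕ) : MvPolynomial (Fin n) ℚ := ∑ i : Fin n, MvPolynomial.X i *
    (MvPolynomial.C (i.val + 1 : ℚ) * (s - MvPolynomial.C (i.val + 1 : ℚ)) ^ (m - 1))
  have heval (k : Fin n → ℚ) : MvPolynomial.eval k (∑ lam : n.Partition,
      MvPolynomial.C (d lam) * (lam.parts.map g).prod) = ∑ lam : n.Partition,
        d lam * (lam.parts.map fun m => MvPolynomial.eval k (g m)).prod := by
    simp only [map_sum, map_mul, MvPolynomial.eval_C, map_multiset_prod, Multiset.map_map]
    rfl
  have hF : ∑ lam : n.Partition, MvPolynomial.C (d lam) * (lam.parts.map g).prod = 0 := by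
    refine MvPolynomial.funext_set (fun _ => Set.range ((↑) : ℕ → ℚ))
      (fun _ => Set.infinite_range_of_injective Nat.cast_injective) fun k hk => ?_
    choose k' hk' using fun i => hk i (Set.mem_univ i)
    -- Natural multiplicities are realized by actual colours: `k' i` of them have weight `i + 1`.
    have h0 := h (K := Σ i : Fin n, Fin (k' i)) fun a => (a.1.val + 1 : ℚ)
    rw [map_zero, heval, ← h0]
    have : (fun m => MvPolynomial.eval k (g m)) =
        starSum (fun a : Σ i : Fin n, Fin (k' i) => (a.1.val + 1 : ℚ)) := by
      funext m
      have hs : MvPolynomial.eval k s =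
          ∑ a : Σ i : Fin n, Fin (k' i), (a.1.val + 1 : ℚ) := by
        simp [s, Fintype.sum_sigma, hk', mul_add]
      rw [starSum, ← hs, Fintype.sum_sigma]
      simp [g, hk']
    rw [this]
  obtain ⟨k, hk⟩ := exists_vandermonde_solution n t
  have hgt {m : ℕ} (h1 : 0 < m) (h2 : m ≤ n) : MvPolynomial.eval k (g m) = t m := by
    have hs : MvPolynomial.eval k s = t 1 := by
      have := hk 0 (by omega)
      simpa [s] using this
    have := hk (m - 1) (by omega)
    rw [Nat.sub_add_cancel h1] at this
    rw [← this]
    simp [g, hs]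
  have := heval k
  rw [hF, map_zero] at this
  rw [this]
  refine Finset.sum_congr rfl fun lam _ => ?_
  congr 2
  refine Multiset.map_congr rfl fun m hm => (hgt (lam.parts_pos hm) ?_).symm
  rw [← lam.parts_sum]
  exact Multiset.le_sum_of_mem hm

theorem partList_coe {n : ℕ} (lam : n.Partition) : (partList lam : Multiset ℕ) = lam.parts :=
  Multiset.sort_eq _ _

theorem colorSum_starForest_partList {K R : Type*} [Fintype K] [CommRing R] {n : ℕ}
    (lam : n.Partition) (x : K → R) :
    colorSum (starForest (partList lam)) x = (lam.parts.map (starSum x)).prod := by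
  rw [colorSum_starForest, ← partList_coe, Multiset.map_coe, Multiset.prod_coe]
  intro m hm
  refine lam.parts_pos ?_
  rw [← partList_coe]
  exact hm

theorem IsStarExpansion.unique {V : Type*} [Fintype V] {G : SimpleGraph V} {n : ℕ}
    {c c' : n.Partition → ℚ} (h : IsStarExpansion G c) (h' : IsStarExpansion G c') : c = c' := by
  rw [← sub_eq_zero]
  refine sum_partition_eq_zero_of_colorSums _ fun x => ?_
  have h1 := colorSum_eq_sum (H := fun lam : n.Partition => starForest (partList lam)) h x
  have h2 := colorSum_eq_sum (H := fun lam : n.Partition => starForest (partList lam)) h' x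
  simp only [colorSum_starForest_partList, smul_eq_mul] at h1 h2
  simp only [Pi.sub_apply, sub_mul, Finset.sum_sub_distrib, ← h1, ← h2, sub_self]

/-! ### The order of a graph from its chromatic symmetric function -/

theorem card_blockVertex_partList {n : ℕ} (lam : n.Partition) :
    Fintype.card (BlockVertex (partList lam)) = n := by
  rw [Fintype.card_sigma]
  simp only [Fintype.card_fin]
  have : ∑ i, (partList lam).get i = (partList lam).sum := by
    simp
  rw [this, ← Multiset.sum_coe, partList_coe, lam.parts_sum]

theorem colorSum_one_pos {V : Type*} [Fintype V] (G : SimpleGraph V) :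
    0 < colorSum G fun _ : V => (1 : ℚ) := by
  classical
  unfold colorSum weightedColorings
  refine Finset.sum_pos' (fun f _ => ?_) ⟨id, Finset.mem_univ _, ?_⟩
  · split_ifs <;> simp
  · rw [if_pos fun a b hab => hab.ne]
    simp

/-- Homogeneity: doubling all variables multiplies the colour sum by `2 ^ card V`. With the vertices
as colours the sum is nonzero, because the identity is a proper colouring. -/
theorem card_eq_of_two_pow {V : Type*} [Fintype V] {G : SimpleGraph V} {n : ℕ}
    (h : colorSum G (fun _ : V => (2 : ℚ) * 1) = 2 ^ n * colorSum G fun _ : V => (1 : ℚ)) :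
    Fintype.card V = n := by
  rw [colorSum_mul_left] at h
  have := mul_right_cancel₀ (colorSum_one_pos G).ne' h
  exact Nat.pow_right_injective le_rfl (by exact_mod_cast this)

theorem card_eq_of_chromSym_eq {V W : Type*} [Fintype V] [Fintype W] {G : SimpleGraph V}
    {H : SimpleGraph W} (h : chromSym G = chromSym H) : Fintype.card V = Fintype.card W := by
  refine card_eq_of_two_pow (G := G) ?_
  rw [colorSum_eq_of_chromSym_eq h, colorSum_mul_left, colorSum_eq_of_chromSym_eq h]

theorem IsStarExpansion.card_eq {V : Type*} [Fintype V] {G : SimpleGraph V} {n : ℕ}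
    {c : n.Partition → ℚ} (h : IsStarExpansion G c) : Fintype.card V = n := by
  have h1 {K : Type _} [Fintype K] (x : K → ℚ) :=
    colorSum_eq_sum (H := fun lam : n.Partition => starForest (partList lam)) h x
  refine card_eq_of_two_pow (G := G) ?_
  rw [h1, h1, Finset.mul_sum]
  refine Finset.sum_congr rfl fun lam _ => ?_
  rw [colorSum_mul_left, card_blockVertex_partList, smul_eq_mul, smul_eq_mul]
  ring

/-! ### Lexicographic comparison, merging of parts and the coefficients -/

theorem List.lt_cons_of_forall_lt {α : Type*} [LinearOrder α] {l l' : List α} {P : α}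
    (h : ∀ a ∈ l, a < P) : l < P :: l' := by
  cases l with
  | nil => exact List.nil_lt_cons _ _
  | cons a l => exact List.cons_lt_cons_iff.2 (Or.inl (h a (by simp)))

/-- Let `r` be the largest element of `R`. If `r < P`, then `P` heads the right list and exceeds
everything in the left one. Otherwise `r` heads both lists and can be removed. -/
theorem Multiset.sort_add_lt_sort_add_cons {α : Type*} [LinearOrder α] (R : Multiset α)
    {A B : Multiset α} {P : α} (hA : ∀ a ∈ A, a < P) (hB : ∀ b ∈ B, b ≤ P) :
    (R + A).sort (· ≥ ·) < (R + P ::ₘ B).sort (· ≥ ·) := by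
  induction h : R.card generalizing R with
  | zero =>
    obtain rfl := Multiset.card_eq_zero.1 h
    rw [zero_add, zero_add, Multiset.sort_cons _ _ _ hB]
    exact List.lt_cons_of_forall_lt fun a ha => hA a ((Multiset.mem_sort _).1 ha)
  | succ k ih =>
    have hR : R.toFinset.Nonempty := by
      rw [Multiset.toFinset_nonempty]
      rintro rfl
      simp at h
    obtain ⟨r, hr, hmax⟩ := R.toFinset.exists_max_image id hR
    simp only [Multiset.mem_toFinset, id] at hr hmax
    by_cases hP : r < P
    · rw [Multiset.add_cons, Multiset.sort_cons]
      · refine List.lt_cons_of_forall_lt fun a ha => ?_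
        rcases Multiset.mem_add.1 ((Multiset.mem_sort _).1 ha) with ha | ha
        · exact (hmax a ha).trans_lt hP
        · exact hA a ha
      · intro b hb
        rcases Multiset.mem_add.1 hb with hb | hb
        · exact ((hmax b hb).trans_lt hP).le
        · exact hB b hb
    · obtain ⟨R', rfl⟩ := Multiset.exists_cons_of_mem hr
      have hPr : P ≤ r := not_lt.1 hP
      rw [Multiset.cons_add, Multiset.cons_add, Multiset.sort_cons, Multiset.sort_cons,
        List.cons_lt_cons_iff]
      · exact Or.inr ⟨rfl, ih R' (by simpa using h)⟩
      · intro b hb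
        rcases Multiset.mem_add.1 hb with hb | hb
        · exact hmax b (Multiset.mem_cons_of_mem hb)
        · rcases Multiset.mem_cons.1 hb with rfl | hb
          · exact hPr
          · exact (hB b hb).trans hPr
      · intro b hb
        rcases Multiset.mem_add.1 hb with hb | hb
        · exact hmax b (Multiset.mem_cons_of_mem hb)
        · exact (hA b hb).le.trans hPr

theorem card_le_sum_of_pos {ι : Type*} {q : ι → ℕ} {S : Finset ι} (hq : ∀ i, 0 < q i) : S.card ≤ ∑ i ∈ S, q i := by
  rw [Finset.card_eq_sum_ones]
  exact Finset.sum_le_sum fun i _ => hq i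

/-- The parts that result from the parts `p` and `q i` by merging `p` with the parts `q i`, `i ∈ S`,
and then splitting off `j` parts equal to `1`. -/
def mergeParts {ι : Type*} [Fintype ι] [DecidableEq ι] (p : ℕ) (q : ι → ℕ) (S : Finset ι) (j : ℕ) :
    Multiset ℕ :=
  (p + ∑ i ∈ S, q i - j) ::ₘ (Multiset.replicate j 1 + Sᶜ.val.map q)

/-- The coefficients in the star basis of the graph obtained by joining the centers of stars of
orders `q i` to the center of a star of order `p`. -/
def joinCoeff {ι : Type*} [Fintype ι] [DecidableEq ι] {n : ℕ} (p : ℕ) (q : ι → ℕ)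
    (mu : n.Partition) : ℚ :=
  ∑ S : Finset ι, ∑ j ∈ Finset.range (S.card + 1),
    if mu.parts = mergeParts p q S j then (-1) ^ j * (S.card.choose j : ℚ) else 0

section Merge

variable {ι : Type*} [Fintype ι] [DecidableEq ι] {p : ℕ} {q : ι → ℕ} {S : Finset ι} {j : ℕ}

theorem map_compl_add_map (q : ι → ℕ) (S : Finset ι) :
    Sᶜ.val.map q + S.val.map q = Finset.univ.val.map q := by
  rw [← Multiset.map_add, ← Finset.disjUnion_val _ _ disjoint_compl_left,
    Finset.disjUnion_eq_union, Finset.union_comm, Finset.union_compl]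

theorem mergeParts_sum (hq : ∀ i, 0 < q i) (hj : j ≤ S.card) :
    (mergeParts p q S j).sum = p + ∑ i, q i := by
  have h1 := card_le_sum_of_pos (S := S) hq
  have h2 := Finset.sum_compl_add_sum S q
  have h3 : (Sᶜ.val.map q).sum = ∑ i ∈ Sᶜ, q i := rfl
  rw [mergeParts, Multiset.sum_cons, Multiset.sum_add, Multiset.sum_replicate, h3]
  simp only [smul_eq_mul, mul_one]
  omega

theorem mergeParts_pos (hp : 0 < p) (hq : ∀ i, 0 < q i) (hj : j ≤ S.card) {m : ℕ}
    (hm : m ∈ mergeParts p q S j) : 0 < m := by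
  have h1 := card_le_sum_of_pos (S := S) hq
  rw [mergeParts, Multiset.mem_cons, Multiset.mem_add] at hm
  rcases hm with rfl | hm | hm
  · omega
  · rw [Multiset.eq_of_mem_replicate hm]; exact one_pos
  · obtain ⟨i, -, rfl⟩ := Multiset.mem_map.1 hm
    exact hq i

theorem mergeParts_empty : mergeParts p q ∅ 0 = p ::ₘ Finset.univ.val.map q := by
  simp [mergeParts]

theorem mergeParts_singleton_zero (i : ι) :
    mergeParts p q {i} 0 = (p + q i) ::ₘ ({i}ᶜ : Finset ι).val.map q := by
  simp [mergeParts]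

theorem cons_map_univ (i : ι) : p ::ₘ Finset.univ.val.map q =
    p ::ₘ q i ::ₘ ({i}ᶜ : Finset ι).val.map q := by
  rw [← map_compl_add_map q {i}, Finset.singleton_val, Multiset.map_singleton,
    Multiset.add_comm, Multiset.singleton_add]

theorem mergeParts_singleton_one (i : ι) :
    mergeParts 1 q {i} 1 = 1 ::ₘ Finset.univ.val.map q := by
  rw [cons_map_univ i, Multiset.cons_swap]
  simp [mergeParts]

/-- For nonempty `S` the merged part exceeds `p` by at least `2|S| - j > 0`, and exceeds each `q i`,
`i ∈ S`, by at least `p + 2(|S| - 1) - j`. The latter is positive unless `p = |S| = j = 1`. The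
parts outside `S` are common to both sides. -/
theorem mergeParts_trichotomy (hp : 0 < p) (hq : ∀ i, 2 ≤ q i) (hj : j ≤ S.card) :
    S = ∅ ∧ j = 0 ∨ p = 1 ∧ S.card = 1 ∧ j = 1 ∨
      (p ::ₘ Finset.univ.val.map q).sort (· ≥ ·) < (mergeParts p q S j).sort (· ≥ ·) := by
  rcases S.eq_empty_or_nonempty with rfl | hS
  · exact Or.inl ⟨rfl, by simpa using hj⟩
  refine Or.inr (or_iff_not_imp_left.2 fun h => ?_)
  have hcard := hS.card_pos
  have hsum (i) (hi : i ∈ S) : q i + 2 * (S.card - 1) ≤ ∑ i ∈ S, q i := by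
    rw [← Finset.add_sum_erase S q hi, ← Finset.card_erase_of_mem hi, mul_comm, ← smul_eq_mul,
      ← Finset.sum_const]
    exact Nat.add_le_add_left (Finset.sum_le_sum fun i _ => hq i) _
  rw [mergeParts, ← map_compl_add_map q S, ← Multiset.add_cons, Multiset.add_comm (.replicate j 1),
    ← Multiset.add_cons]
  refine Multiset.sort_add_lt_sort_add_cons _ ?_ ?_
  · intro a ha
    rcases Multiset.mem_cons.1 ha with rfl | ha
    · obtain ⟨i, hi⟩ := hS
      have := hsum i hi
      have := hq i
      omega
    · obtain ⟨i, hi, rfl⟩ := Multiset.mem_map.1 ha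
      have := hsum i hi
      have := hq i
      omega
  · intro b hb
    rw [Multiset.eq_of_mem_replicate hb]
    obtain ⟨i, hi⟩ := hS
    have := hsum i hi
    have := hq i
    omega

variable {n : ℕ} {lam : n.Partition}

theorem joinCoeff_self (hp : 0 < p) (hq : ∀ i, 2 ≤ q i)
    (hlam : lam.parts = p ::ₘ Finset.univ.val.map q) :
    joinCoeff p q lam = 1 - if p = 1 then (Fintype.card ι : ℚ) else 0 := by
  -- The empty set contributes `1`. If `p = 1`, every singleton contributes `-1` through `j = 1`: it
  -- merges the part `1` and splits it off again.
  have hS (S : Finset ι) : (∑ j ∈ Finset.range (S.card + 1),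
      if lam.parts = mergeParts p q S j then (-1) ^ j * (S.card.choose j : ℚ) else 0) =
      (if S = ∅ then 1 else 0) - if S ∈ Finset.powersetCard 1 Finset.univ then
        (if p = 1 then 1 else 0) else 0 := by
    simp only [Finset.mem_powersetCard_univ]
    by_cases h0 : S = ∅
    · subst h0
      simp [hlam, mergeParts_empty]
    by_cases h1 : p = 1 ∧ S.card = 1
    · obtain ⟨rfl, h1⟩ := h1
      obtain ⟨i, rfl⟩ := Finset.card_eq_one.1 h1
      rw [Finset.sum_eq_single 1]
      · simp [hlam, mergeParts_singleton_one]
      · intro j hj hj1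
        have hj' : j ≤ ({i} : Finset ι).card := Nat.lt_succ_iff.1 (Finset.mem_range.1 hj)
        rcases mergeParts_trichotomy hp hq hj' with h | h | h
        · simp at h
        · exact absurd h.2.2 hj1
        · rw [hlam, if_neg fun h' => h.ne (congrArg _ h')]
      · intro h
        simp at h
    · rw [Finset.sum_eq_zero]
      · rw [if_neg h0]
        split_ifs <;> simp_all
      · intro j hj
        have hj' : j ≤ S.card := Nat.lt_succ_iff.1 (Finset.mem_range.1 hj)
        rcases mergeParts_trichotomy hp hq hj' with h | h | h
        · exact absurd h.1 h0
        · exact absurd ⟨h.1, h.2.1⟩ h1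
        · rw [hlam, if_neg fun h' => h.ne (congrArg _ h')]
  rw [joinCoeff, Finset.sum_congr rfl fun S _ => hS S, Finset.sum_sub_distrib]
  congr 1
  · simp
  · rw [← Finset.sum_filter, Finset.filter_mem_eq_inter, Finset.univ_inter, Finset.sum_const,
      Finset.card_powersetCard]
    simp

theorem isLeadingPartition_joinCoeff (hp : 0 < p) (hq : ∀ i, 2 ≤ q i) (hι : 2 ≤ Fintype.card ι)
    (hlam : lam.parts = p ::ₘ Finset.univ.val.map q) :
    IsLeadingPartition (joinCoeff p q) lam := by
  constructor
  · rw [joinCoeff_self hp hq hlam]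
    have : (2 : ℚ) ≤ Fintype.card ι := by exact_mod_cast hι
    split_ifs
    · linarith
    · norm_num
  · intro mu hmu
    obtain ⟨S, -, hS⟩ := Finset.exists_ne_zero_of_sum_ne_zero hmu
    obtain ⟨j, hj, hSj⟩ := Finset.exists_ne_zero_of_sum_ne_zero hS
    have hj' : j ≤ S.card := Nat.lt_succ_iff.1 (Finset.mem_range.1 hj)
    have hm : mu.parts = mergeParts p q S j := by
      by_contra h
      exact hSj (if_neg h)
    unfold partList
    rw [hm, hlam]
    rcases mergeParts_trichotomy hp hq hj' with ⟨rfl, rfl⟩ | ⟨rfl, h, rfl⟩ | h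
    · rw [mergeParts_empty]
    · obtain ⟨i, rfl⟩ := Finset.card_eq_one.1 h
      rw [mergeParts_singleton_one]
    · exact h.le

/-- The absence of ones forces `j = 0`, and then the length forces `|S| = 1`. Several `i` may yield
the same partition, so the coefficient is a count. -/
theorem joinCoeff_mergeIndex (hlam : lam.parts = p ::ₘ Finset.univ.val.map q)
    (mu : MergeIndex lam) : joinCoeff p q mu.1 =
      ∑ i, if mu.1.parts = mergeParts p q {i} 0 then 1 else 0 := by
  have hcard : mu.1.parts.card = Fintype.card ι := by
    have h1 := mu.2.2
    have h2 : lam.parts.card = Fintype.card ι + 1 := by simp [hlam]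
    omega
  have hS (S : Finset ι) : (∑ j ∈ Finset.range (S.card + 1),
      if mu.1.parts = mergeParts p q S j then (-1) ^ j * (S.card.choose j : ℚ) else 0) =
      if S ∈ Finset.powersetCard 1 Finset.univ then
        (if mu.1.parts = mergeParts p q S 0 then 1 else 0) else 0 := by
    have key (j : ℕ) (h : mu.1.parts = mergeParts p q S j) : j = 0 ∧ S.card = 1 := by
      have hj : j = 0 := by
        by_contra h0
        refine mu.2.1 ?_
        rw [h, mergeParts, Multiset.mem_cons, Multiset.mem_add]
        exact Or.inr (Or.inl (Multiset.mem_replicate.2 ⟨h0, rfl⟩))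
      subst hj
      rw [h, mergeParts, Multiset.card_cons, Multiset.card_add, Multiset.card_replicate,
        Multiset.card_map, Finset.card_val, Finset.card_compl] at hcard
      have := S.card_le_univ
      have : 0 < Fintype.card ι := by omega
      omega
    simp only [Finset.mem_powersetCard_univ]
    rw [Finset.sum_eq_single 0]
    · by_cases h : mu.1.parts = mergeParts p q S 0
      · simp [h, (key 0 h).2]
      · simp [h]
    · intro j _ hj
      exact if_neg fun h => hj (key j h).1
    · simp
  rw [joinCoeff, Finset.sum_congr rfl fun S _ => hS S, ← Finset.sum_filter,
    Finset.filter_mem_eq_inter, Finset.univ_inter, Finset.powersetCard_one, Finset.sum_map]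
  rfl

/-- After interchanging the sums, each `i` contributes through its own merged partition, whose
difference from `lam` is `{p, q i}`. The new part `p + q i` differs from both and cancels neither.
-/
theorem partWeight_joinCoeff (hp : 2 ≤ p) (hq : ∀ i, 2 ≤ q i)
    (hlam : lam.parts = p ::ₘ Finset.univ.val.map q) (r : ℕ) :
    partWeight lam (fun mu => joinCoeff p q mu.1) r =
      (if r = p then (Fintype.card ι : ℚ) else 0) + (Finset.univ.val.map q).count r := by
  have hp' : 0 < p := by omega
  have hq' (i : ι) : 0 < q i := by have := hq i; omega
  have hn : p + ∑ i, q i = n := by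
    rw [← lam.parts_sum, hlam, Multiset.sum_cons]
    rfl
  have hi (i : ι) : ∃ mu : MergeIndex lam, mu.1.parts = mergeParts p q {i} 0 := by
    refine ⟨⟨⟨mergeParts p q {i} 0, fun {m} hm => mergeParts_pos hp' hq' (Nat.zero_le _) hm,
      (mergeParts_sum hq' (Nat.zero_le _)).trans hn⟩, ?_, ?_⟩, rfl⟩
    · change 1 ∉ mergeParts p q {i} 0
      rw [mergeParts_singleton_zero, Multiset.mem_cons, Multiset.mem_map]
      rintro (h | ⟨k, -, h⟩)
      · omega
      · have := hq k
        omega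
    · change (mergeParts p q {i} 0).card + 1 = _
      rw [hlam, cons_map_univ i, mergeParts_singleton_zero]
      simp
  choose mu hmu using hi
  simp only [partWeight, joinCoeff_mergeIndex hlam, Finset.mul_sum]
  rw [Finset.sum_comm]
  have h1 (i : ι) : ∑ nu : MergeIndex lam, ((lam.parts - nu.1.parts).count r : ℚ) *
      (if nu.1.parts = mergeParts p q {i} 0 then 1 else 0) =
        (if r = p then 1 else 0) + if r = q i then 1 else 0 := by
    rw [Fintype.sum_eq_single (mu i)]
    · rw [if_pos (hmu i), hmu i, mul_one, Multiset.count_sub, hlam, cons_map_univ i,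
        mergeParts_singleton_zero]
      simp only [Multiset.count_cons]
      have := hq i
      have h : ∀ a : ℕ, (a + (if r = q i then 1 else 0) + (if r = p then 1 else 0)) -
          (a + if r = p + q i then 1 else 0) =
            (if r = p then 1 else 0) + if r = q i then 1 else 0 := by
        intro a
        split_ifs <;> omega
      rw [h]
      push_cast
      rfl
    · intro nu hnu
      rw [if_neg, mul_zero]
      intro h
      exact hnu (Subtype.ext (Nat.Partition.ext (h.trans (hmu i).symm)))
  rw [Finset.sum_congr rfl fun i _ => h1 i, Finset.sum_add_distrib]
  congr 1
  · simp
  · rw [Multiset.count_map, ← Finset.filter_val, Finset.card_val, Finset.card_filter]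
    push_cast
    rfl

theorem centralOrder_joinCoeff (hp : 0 < p) (hq : ∀ i, 2 ≤ q i) (hι : 2 ≤ Fintype.card ι)
    (hlam : lam.parts = p ::ₘ Finset.univ.val.map q) :
    centralOrder lam (fun mu => joinCoeff p q mu.1) = p := by
  unfold centralOrder
  split_ifs with h
  · rw [hlam, Multiset.mem_cons, Multiset.mem_map] at h
    rcases h with h | ⟨i, -, h⟩
    · exact h
    · have := hq i
      omega
  · have hp1 : p ≠ 1 := by
      rintro rfl
      exact h (by simp [hlam])
    -- The multiplicity in `lam` counts `p` once besides the `q i`, whereas `N` counts it `card ι ≥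
    -- 2` times. All other values agree, so only `p` passes the test and the default `0` is never
    -- reached.
    have key (r : ℕ) : ((lam.parts.count r : ℚ) <
        partWeight lam (fun mu => joinCoeff p q mu.1) r) ↔ r = p := by
      rw [partWeight_joinCoeff (by omega) hq hlam, hlam, Multiset.count_cons]
      have : (2 : ℚ) ≤ Fintype.card ι := by exact_mod_cast hι
      push_cast
      split_ifs with hr
      · simp only [hr, iff_true]
        linarith
      · simp [hr]
    cases hf : (partList lam).find? fun r => decide ((lam.parts.count r : ℚ) <
        partWeight lam (fun mu => joinCoeff p q mu.1) r) with
    | none =>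
      rw [List.find?_eq_none] at hf
      refine absurd (hf p ?_) (by simp [key])
      rw [← Multiset.mem_coe, partList_coe, hlam]
      simp
    | some r =>
      have := List.find?_some hf
      simpa [key] using this

end Merge

theorem isStarExpansion_joinCoeff {V : Type*} [Fintype V] {G : SimpleGraph V} {n p : ℕ}
    {l : List ℕ} (e : G ≃g joinedStars (p :: l)) (hp : 0 < p) (hl : ∀ m ∈ l, 0 < m)
    (hn : p + l.sum = n) : IsStarExpansion G (joinCoeff p l.get : n.Partition → ℚ) := by
  have hpos (i : Fin l.length) : 0 < l.get i := hl _ (l.get_mem i)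
  have hsum : p + ∑ i, l.get i = n := by simpa using hn
  refine (chromSym_eq_sum_iff G (fun lam : n.Partition => starForest (partList lam)) _).2
    fun N => ?_
  simp only [chromPoly]
  rw [colorSum_congr e, colorSum_joinedStars_expansion p l hp hl]
  simp only [colorSum_starForest_partList, joinCoeff, Finset.sum_smul]
  rw [Finset.sum_comm]
  refine Finset.sum_congr rfl fun S _ => ?_
  rw [Finset.sum_comm]
  refine Finset.sum_congr rfl fun j hj => ?_
  have hj' : j ≤ S.card := Nat.lt_succ_iff.1 (Finset.mem_range.1 hj)
  rw [Fintype.sum_eq_single ⟨mergeParts p l.get S j, fun {m} hm => mergeParts_pos hp hpos hj' hm,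
    (mergeParts_sum hpos hj').trans hsum⟩]
  · rw [if_pos rfl]
    change _ = _ • (Multiset.map _ (mergeParts p l.get S j)).prod
    rw [mergeParts, Multiset.map_cons, Multiset.prod_cons, Multiset.map_add,
      Multiset.prod_add, Multiset.map_replicate, Multiset.prod_replicate, Multiset.map_map,
      Algebra.smul_def, map_mul, map_pow, map_neg, map_one, map_natCast, mul_assoc (starSum _ _)]
    rfl
  · intro mu hmu
    rw [if_neg, zero_smul]
    intro h
    exact hmu (Nat.Partition.ext h)

/-! ### Trees of diameter four as joined stars -/

theorem exists_equiv_of_map_univ_eq {ι κ α : Type*} [Fintype ι] [Fintype κ] {f : ι → α}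
    {g : κ → α} (h : Finset.univ.val.map f = Finset.univ.val.map g) :
    ∃ e : ι ≃ κ, ∀ i, g (e i) = f i := by
  classical
  have hcard (a : α) : Nonempty ({i // f i = a} ≃ {k // g k = a}) := by
    refine Fintype.card_eq.1 ?_
    have := congrArg (Multiset.count a) h
    rw [Multiset.count_map, Multiset.count_map, ← Finset.filter_val, ← Finset.filter_val,
      Finset.card_val, Finset.card_val] at this
    rw [Fintype.card_subtype, Fintype.card_subtype]
    simpa only [eq_comm] using this
  let E := (Equiv.sigmaFiberEquiv f).symm.trans
    ((Equiv.sigmaCongrRight fun a => (hcard a).some).trans (Equiv.sigmaFiberEquiv g))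
  exact ⟨E, fun i => ((hcard (f i)).some ⟨i, rfl⟩).2⟩

theorem exists_equiv_fin_apply_zero {α : Type*} [Fintype α] {m : ℕ} (hm : Fintype.card α = m)
    (a : α) : ∃ e : Fin m ≃ α, ∀ j : Fin m, e j = a ↔ j.val = 0 := by
  classical
  subst hm
  let z : Fin (Fintype.card α) := ⟨0, Fintype.card_pos_iff.2 ⟨a⟩⟩
  let e0 := (Fintype.equivFin α).symm
  refine ⟨e0.trans (Equiv.swap (e0 z) a), fun j => ?_⟩
  rw [Equiv.trans_apply, Equiv.swap_apply_eq_iff, Equiv.swap_apply_right, e0.injective.eq_iff,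
    Fin.ext_iff]

/-- A graph whose vertices are partitioned into stars with centers `c a` such that the only other
edges join the center `v` to the remaining centers is isomorphic to a `joinedStars`. -/
theorem nonempty_iso_joinedStars {V : Type*} [Fintype V] [DecidableEq V] {G : SimpleGraph V} {v : V}
    {c : V → V} (hcc : ∀ a, c (c a) = c a) (hv : c v = v)
    (hadj : ∀ a b, G.Adj a b ↔ (c a = c b ∧ Xor (a = c a) (b = c b)) ∨
      (c a ≠ c b ∧ a = c a ∧ b = c b ∧ (a = v ∨ b = v))) {p : ℕ}
    (hp : Fintype.card {a // c a = v} = p) {l : List ℕ}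
    (hl : (l : Multiset ℕ) = (Finset.univ : Finset {u // c u = u ∧ u ≠ v}).val.map
      fun u => Fintype.card {a // c a = u.1}) :
    Nonempty (G ≃g joinedStars (p :: l)) := by
  obtain ⟨e, he⟩ := exists_equiv_of_map_univ_eq (f := l.get)
    (g := fun u : {u // c u = u ∧ u ≠ v} => Fintype.card {a // c a = u.1})
    (by rw [← hl]; simp)
  let E : Fin (p :: l).length → V := Fin.cons v fun i => (e i).1
  have hE0 : E 0 = v := rfl
  have hEs (i : Fin l.length) : E i.succ = (e i).1 := rfl
  have hEi : Function.Injective E := by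
    refine Fin.cons_injective_iff.2 ⟨?_, Subtype.val_injective.comp e.injective⟩
    rintro ⟨i, hi⟩
    exact (e i).2.2 hi
  have hEc (i) : c (E i) = E i := by
    refine Fin.cases hv (fun i => (e i).2.1) i
  have hEsurj (a : V) : ∃ i, E i = c a := by
    by_cases h : c a = v
    · exact ⟨0, h.symm⟩
    · refine ⟨Fin.succ (e.symm ⟨c a, hcc a, h⟩), ?_⟩
      rw [hEs, Equiv.apply_symm_apply]
  have hcard (i : Fin (p :: l).length) : Fintype.card {a // c a = E i} = (p :: l).get i := by
    refine Fin.cases hp (fun i => ?_) i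
    exact he i
  choose ψ hψ using fun i => exists_equiv_fin_apply_zero (hcard i) ⟨E i, hEc i⟩
  have hc (x : BlockVertex (p :: l)) : c (ψ x.1 x.2).1 = E x.1 := (ψ x.1 x.2).2
  have hz (x : BlockVertex (p :: l)) : (ψ x.1 x.2).1 = E x.1 ↔ x.2.val = 0 := by
    rw [← hψ, Subtype.ext_iff]
  let F : BlockVertex (p :: l) ≃ V := Equiv.ofBijective (fun x => (ψ x.1 x.2).1) (by
    constructor
    · rintro ⟨i, j⟩ ⟨i', j'⟩ h
      have hi : i = i' := by
        apply hEi
        rw [← hc ⟨i, j⟩, ← hc ⟨i', j'⟩]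
        exact congrArg c h
      subst hi
      exact congrArg _ ((ψ i).injective (Subtype.ext h))
    · intro a
      obtain ⟨i, hi⟩ := hEsurj a
      refine ⟨⟨i, (ψ i).symm ⟨a, hi.symm⟩⟩, ?_⟩
      simp)
  refine ⟨RelIso.symm ⟨F, fun {x y} => ?_⟩⟩
  change G.Adj (ψ x.1 x.2).1 (ψ y.1 y.2).1 ↔ _
  rw [hadj, hc, hc, hEi.eq_iff, hz, hz]
  change _ ↔ (x.1 = y.1 ∧ _) ∨ _
  refine or_congr Iff.rfl (and_congr (not_congr hEi.eq_iff) (and_congr_right fun hx =>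
    and_congr_right fun hy => ?_))
  have h0 (x : BlockVertex (p :: l)) (hx : x.2.val = 0) : (ψ x.1 x.2).1 = v ↔ x.1.val = 0 := by
    rw [(hz x).2 hx, ← hE0, hEi.eq_iff, Fin.ext_iff]
    rfl
  rw [h0 x hx, h0 y hy]

section Tree

variable {V : Type*} {T : SimpleGraph V}

/-- A neighbour of `v` closer to `w` is the penultimate vertex of the path from `w` to `v`, which is
unique in a tree. -/
theorem SimpleGraph.IsTree.eq_of_adj_of_dist (hT : T.IsTree) {w v x y : V} (hx : T.Adj x v)
    (hy : T.Adj y v) (hdx : T.dist w v = T.dist w x + 1) (hdy : T.dist w v = T.dist w y + 1) :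
    x = y := by
  obtain ⟨p, hp, hp'⟩ := hT.connected.exists_path_of_dist w x
  obtain ⟨q, hq, hq'⟩ := hT.connected.exists_path_of_dist w y
  have h1 : (p.concat hx).IsPath := SimpleGraph.Walk.isPath_of_length_eq_dist _ (by
    rw [SimpleGraph.Walk.length_concat, hp', hdx])
  have h2 : (q.concat hy).IsPath := SimpleGraph.Walk.isPath_of_length_eq_dist _ (by
    rw [SimpleGraph.Walk.length_concat, hq', hdy])
  have := congrArg Subtype.val ((hT.isAcyclic.subsingleton_path w v).elim ⟨_, h1⟩ ⟨_, h2⟩)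
  have := congrArg SimpleGraph.Walk.penultimate this
  simpa using this

/-- On a diametral path `a, b, v, d, e`, a vertex `w` at distance at least `3` from `v` would have
both `b` and `d` closer to it than `v`, against the uniqueness of such a neighbour. -/
theorem SimpleGraph.IsTree.exists_center (hT : T.IsTree) (hd : T.diam = 4) :
    ∃ v b d, (∀ w, T.dist v w ≤ 2) ∧ b ≠ d ∧ (T.Adj v b ∧ ∃ x, x ≠ v ∧ T.Adj b x) ∧
      (T.Adj v d ∧ ∃ x, x ≠ v ∧ T.Adj d x) := by
  have hle (x y : V) : T.dist x y ≤ 4 :=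
    hd ▸ SimpleGraph.dist_le_diam (SimpleGraph.ediam_ne_top_of_diam_ne_zero (by omega))
  have : Nonempty V := hT.connected.nonempty
  obtain ⟨a, e, hae⟩ := T.exists_dist_eq_diam
  rw [hd] at hae
  obtain ⟨p, hp⟩ := hT.connected.exists_walk_length_eq_dist a e
  rw [hae] at hp
  have h01 := p.adj_getVert_succ (i := 0) (by omega)
  have h12 := p.adj_getVert_succ (i := 1) (by omega)
  have h23 := p.adj_getVert_succ (i := 2) (by omega)
  have h34 := p.adj_getVert_succ (i := 3) (by omega)
  have hp4 := p.getVert_length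
  rw [hp] at hp4
  simp only [SimpleGraph.Walk.getVert_zero, zero_add, Nat.reduceAdd, hp4] at h01 h12 h23 h34
  generalize p.getVert 1 = b at *
  generalize p.getVert 2 = v at *
  generalize p.getVert 3 = d at *
  have tri := fun x y z => hT.connected.dist_triangle (u := x) (v := y) (w := z)
  have e1 := SimpleGraph.dist_eq_one_iff_adj.2 h01
  have e2 := SimpleGraph.dist_eq_one_iff_adj.2 h12
  have e3 := SimpleGraph.dist_eq_one_iff_adj.2 h23
  have e4 := SimpleGraph.dist_eq_one_iff_adj.2 h34
  have hav : a ≠ v := by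
    rintro rfl
    have := tri a d e
    omega
  have hev : e ≠ v := by
    rintro rfl
    have := tri a b e
    omega
  have hbd : b ≠ d := by
    rintro rfl
    have := tri a b e
    omega
  -- If `x` were farther from `w` than `v`, it would be at distance at least `4`. Then `y` would be
  -- either a second closer neighbour of `x` besides `v`, or at distance at least `5`.
  have far (w x y : V) (hxv : T.Adj v x) (hyx : T.Adj x y) (hyv : y ≠ v) (hw : 3 ≤ T.dist w v) :
      T.dist w v = T.dist w x + 1 := by
    refine (hT.dist_eq_dist_add_one_of_adj w hxv).resolve_right fun h => ?_
    rcases hT.dist_eq_dist_add_one_of_adj w hyx with h' | h'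
    · exact hyv (hT.eq_of_adj_of_dist hyx.symm hxv h' h)
    · have := hle w y
      omega
  refine ⟨v, b, d, fun w => ?_, hbd, ⟨h12.symm, a, hav, h01.symm⟩, h23, e, hev, h34⟩
  by_contra hw
  rw [SimpleGraph.dist_comm] at hw
  exact hbd (hT.eq_of_adj_of_dist h12 h23.symm (far w b a h12.symm h01.symm hav (by omega))
    (far w d e h23 h34 hev (by omega)))

/-- The orders of the outer stars form a multiset and any enumeration `l` is allowed, so that the
list produced by the algorithm can be used directly. -/
theorem SimpleGraph.IsTree.exists_iso_joinedStars [Fintype V] (hT : T.IsTree) (hd : T.diam = 4) :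
    ∃ (p : ℕ) (s : Multiset ℕ), 0 < p ∧ (∀ m ∈ s, 2 ≤ m) ∧ 2 ≤ s.card ∧
      ∀ l : List ℕ, (l : Multiset ℕ) = s → Nonempty (T ≃g joinedStars (p :: l)) := by
  classical
  obtain ⟨v, b, d, h2, hbd, hb, hd'⟩ := hT.exists_center hd
  let U (u : V) : Prop := T.Adj v u ∧ ∃ x, x ≠ v ∧ T.Adj u x
  have d1 {u : V} (h : T.Adj v u) : T.dist v u = 1 := SimpleGraph.dist_eq_one_iff_adj.2 h
  have d2 {u w : V} (hu : T.Adj v u) (hw : T.Adj u w) (hwv : w ≠ v) : T.dist v w = 2 := by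
    have h1 := hT.dist_ne_of_adj v hw
    have h3 := h2 w
    have h4 := hT.connected.pos_dist_of_ne hwv.symm
    rw [d1 hu] at h1
    omega
  have huniq {u u' w : V} (hu : T.Adj v u) (hw : T.Adj u w) (hu' : T.Adj v u')
      (hw' : T.Adj u' w) (hwv : w ≠ v) : u = u' :=
    hT.eq_of_adj_of_dist hw hw' (by rw [d1 hu, d2 hu hw hwv]) (by rw [d1 hu', d2 hu hw hwv])
  -- The center of the star that contains `w`: a nonleaf neighbour of `v` is its own center, `v` and
  -- its leaf neighbours belong to `v`, and a vertex at distance two belongs to its neighbour in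
  -- `U`.
  have hex (w : V) : ∃ u, (U w ∧ u = w) ∨ ((w = v ∨ T.Adj v w ∧ ¬ U w) ∧ u = v) ∨
      (w ≠ v ∧ ¬ T.Adj v w ∧ U u ∧ T.Adj u w) := by
    by_cases h : w = v
    · exact ⟨v, Or.inr (Or.inl ⟨Or.inl h, rfl⟩)⟩
    by_cases h1 : T.Adj v w
    · by_cases hU : U w
      · exact ⟨w, Or.inl ⟨hU, rfl⟩⟩
      · exact ⟨v, Or.inr (Or.inl ⟨Or.inr ⟨h1, hU⟩, rfl⟩)⟩
    · obtain ⟨p, hp⟩ := hT.connected.exists_walk_length_eq_dist v w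
      have hlen : p.length = 2 := by
        have h3 := h2 w
        have h4 := hT.connected.pos_dist_of_ne (Ne.symm h)
        have h5 : T.dist v w ≠ 1 := fun h5 => h1 (SimpleGraph.dist_eq_one_iff_adj.1 h5)
        omega
      have a1 := p.adj_getVert_succ (i := 0) (by omega)
      have a2 := p.adj_getVert_succ (i := 1) (by omega)
      have a3 := p.getVert_length
      rw [hlen] at a3
      simp only [SimpleGraph.Walk.getVert_zero, zero_add, Nat.reduceAdd, a3] at a1 a2
      exact ⟨_, Or.inr (Or.inr ⟨h, h1, ⟨a1, w, h, a2⟩, a2⟩)⟩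
  choose c hc using hex
  have hUv {u : V} (hu : U u) : u ≠ v := hu.1.ne'
  have hcU {u : V} (hu : U u) : c u = u := by
    rcases hc u with h | h | h
    · exact h.2
    · rcases h.1 with h1 | h1
      · exact absurd h1 (hUv hu)
      · exact absurd hu h1.2
    · exact absurd hu.1 h.2.1
  have hcv : c v = v := by
    rcases hc v with h | h | h
    · exact h.2
    · exact h.2
    · exact absurd rfl h.1
  have hcN {w : V} (hw : T.Adj v w) (hU : ¬ U w) : c w = v := by
    rcases hc w with h | h | h
    · exact absurd h.1 hU
    · exact h.2
    · exact absurd hw h.2.1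
  have hcF {u w : V} (hu : T.Adj v u) (hw : T.Adj u w) (hwv : w ≠ v) : c w = u := by
    have hnot : ¬ T.Adj v w := fun h => by
      have := d1 h
      rw [d2 hu hw hwv] at this
      omega
    rcases hc w with h | h | h
    · exact absurd h.1.1 hnot
    · rcases h.1 with h1 | h1
      · exact absurd h1 hwv
      · exact absurd h1.1 hnot
    · exact huniq h.2.2.1.1 h.2.2.2 hu hw hwv
  have hcenter {u : V} (h : c u = u) (huv : u ≠ v) : U u := by
    rcases hc u with h1 | h1 | h1
    · exact h1.1
    · exact absurd (h.symm.trans h1.2) huv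
    · rw [h] at h1
      exact h1.2.2.1
  have hcc (a : V) : c (c a) = c a := by
    rcases hc a with h | h | h
    · rw [h.2, hcU h.1]
    · rw [h.2, hcv]
    · exact hcU h.2.2.1
  have edge {a b : V} (hab : T.Adj a b) (hlt : T.dist v b = T.dist v a + 1) :
      (c a = c b ∧ Xor (a = c a) (b = c b)) ∨
      (c a ≠ c b ∧ a = c a ∧ b = c b ∧ (a = v ∨ b = v)) := by
    have hbv : b ≠ v := by
      rintro rfl
      simp at hlt
    by_cases hav : a = v
    · subst hav
      by_cases hU : U b
      · rw [hcU hU, hcv]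
        exact Or.inr ⟨hbv.symm, rfl, rfl, Or.inl rfl⟩
      · rw [hcN hab hU, hcv]
        exact Or.inl ⟨rfl, Or.inl ⟨rfl, hbv⟩⟩
    · have ha1 : T.Adj v a := by
        rw [← SimpleGraph.dist_eq_one_iff_adj]
        have h3 := h2 b
        have h4 := hT.connected.pos_dist_of_ne (Ne.symm hav)
        omega
      rw [hcF ha1 hab hbv, hcU (u := a) ⟨ha1, b, hbv, hab⟩]
      exact Or.inl ⟨rfl, Or.inl ⟨rfl, hab.ne'⟩⟩
  have star {a b : V} (h : c a = c b) (ha : a = c a) (hb : b ≠ c b) : T.Adj a b := by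
    have hab : a = c b := ha.trans h
    rcases hc b with h1 | h1 | h1
    · exact absurd h1.2.symm hb
    · rw [hab, h1.2]
      rcases h1.1 with h2 | h2
      · exact absurd (h2.trans h1.2.symm) hb
      · exact h2.1
    · rw [hab]
      exact h1.2.2.2
  have hadj (a b : V) : T.Adj a b ↔ (c a = c b ∧ Xor (a = c a) (b = c b)) ∨
      (c a ≠ c b ∧ a = c a ∧ b = c b ∧ (a = v ∨ b = v)) := by
    constructor
    · intro hab
      rcases hT.dist_eq_dist_add_one_of_adj v hab with h | h
      · rcases edge hab.symm h with h | h
        · exact Or.inl ⟨h.1.symm, h.2.symm⟩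
        · exact Or.inr ⟨h.1.symm, h.2.2.1, h.2.1, h.2.2.2.symm⟩
      · exact edge hab h
    · rintro (⟨h, ha | hb⟩ | ⟨h, ha, hb, hv | hv⟩)
      · exact star h ha.1 ha.2
      · exact (star h.symm hb.1 hb.2).symm
      · exact hv ▸ (hcenter hb.symm fun hba => h (by rw [hba, hv])).1
      · exact hv ▸ (hcenter ha.symm fun hba => h (by rw [hba, hv])).1.symm
  refine ⟨Fintype.card {a // c a = v}, (Finset.univ : Finset {u // c u = u ∧ u ≠ v}).val.map
      fun u => Fintype.card {a // c a = u.1}, ?_, ?_, ?_,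
      fun l hl => nonempty_iso_joinedStars hcc hcv hadj rfl hl⟩
  · exact Fintype.card_pos_iff.2 ⟨⟨v, hcv⟩⟩
  · intro m hm
    obtain ⟨⟨u, hu, huv⟩, -, rfl⟩ := Multiset.mem_map.1 hm
    obtain ⟨h1, x, hxv, hx⟩ := hcenter hu huv
    refine Fintype.one_lt_card_iff.2 ⟨⟨u, hu⟩, ⟨x, hcF h1 hx hxv⟩, fun h => ?_⟩
    exact hx.ne (congrArg Subtype.val h)
  · rw [Multiset.card_map, Finset.card_val, Finset.card_univ]
    refine Fintype.one_lt_card_iff.2 ⟨⟨b, hcU hb, hUv hb⟩, ⟨d, hcU hd', hUv hd'⟩, fun h => ?_⟩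
    exact hbd (congrArg Subtype.val h)

end Tree

/-! ### The distribution of distances in a tree and its diameter -/

theorem SimpleGraph.IsTree.length_eq_dist {V : Type*} {T : SimpleGraph V} (hT : T.IsTree) {u v : V}
    {p : T.Walk u v} (hp : p.IsPath) : p.length = T.dist u v := by
  obtain ⟨q, hq, hq'⟩ := hT.connected.exists_path_of_dist u v
  have := congrArg Subtype.val ((hT.isAcyclic.subsingleton_path u v).elim ⟨p, hp⟩ ⟨q, hq⟩)
  rw [← hq', show p = q from this]

/-- The graph that results from removing the vertex `x`. -/
abbrev removeVertex {V : Type*} (T : SimpleGraph V) (x : V) : SimpleGraph {z // z ≠ x} :=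
  T.comap Subtype.val

open Classical in
/-- The number of proper colourings with colour `k` at all vertices of `A`. -/
noncomputable def fixedColorings {V K : Type*} [Fintype V] [Fintype K] (T : SimpleGraph V) (k : K)
    (A : Set V) : ℚ :=
  ∑ f : V → K, if (∀ a b, T.Adj a b → f a ≠ f b) ∧ ∀ z ∈ A, f z = k then 1 else 0

section Leaf

variable {V : Type*} {T : SimpleGraph V} {x w : V}

theorem isTree_removeVertex [Fintype V] (hT : T.IsTree) (hw : ∀ z, T.Adj x z ↔ z = w) :
    (removeVertex T x).IsTree := by
  classical
  refine ⟨?_, hT.isAcyclic.comap ⟨Subtype.val, id⟩ Subtype.val_injective⟩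
  refine hT.connected.induce_compl_singleton_of_degree_eq_one (v := x) ?_
  rw [SimpleGraph.degree_eq_one_iff_existsUnique_adj]
  exact ⟨w, (hw w).2 rfl, fun z hz => (hw z).1 hz⟩

theorem exists_isPath_length_eq_dist_removeVertex (hT' : (removeVertex T x).IsTree)
    (u v : {z // z ≠ x}) : ∃ p : T.Walk u.1 v.1, p.IsPath ∧ x ∉ p.support ∧
      p.length = (removeVertex T x).dist u v := by
  obtain ⟨p, hp, hp'⟩ := hT'.connected.exists_path_of_dist u v
  let φ : removeVertex T x →g T := ⟨Subtype.val, id⟩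
  refine ⟨p.map φ, hp.map Subtype.val_injective, ?_, ?_⟩
  · rw [SimpleGraph.Walk.support_map, List.mem_map]
    rintro ⟨z, -, hz⟩
    exact z.2 hz
  · rw [SimpleGraph.Walk.length_map, hp']

theorem dist_removeVertex (hT : T.IsTree) (hT' : (removeVertex T x).IsTree) (u v : {z // z ≠ x}) :
    (removeVertex T x).dist u v = T.dist u.1 v.1 := by
  obtain ⟨p, hp, -, hp'⟩ := exists_isPath_length_eq_dist_removeVertex hT' u v
  rw [← hp', hT.length_eq_dist hp]

theorem dist_leaf (hT : T.IsTree) (hT' : (removeVertex T x).IsTree) (hw : T.Adj x w) {v : V}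
    (hv : v ≠ x) : T.dist x v = T.dist w v + 1 := by
  obtain ⟨p, hp, hx, -⟩ := exists_isPath_length_eq_dist_removeVertex hT' ⟨w, hw.ne'⟩ ⟨v, hv⟩
  rw [← hT.length_eq_dist hp, ← hT.length_eq_dist (hp.cons (h := hw) hx),
    SimpleGraph.Walk.length_cons]

variable [Fintype V] {K : Type*} [Fintype K] {k : K} {A : Set V}

open Classical in
theorem fixedColorings_eq_sum_removeVertex
    (hw : ∀ z, T.Adj x z ↔ z = w) (hwx : w ≠ x) :
    fixedColorings T k A = ∑ g : {z // z ≠ x} → K,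
      if (∀ a b, (removeVertex T x).Adj a b → g a ≠ g b) ∧ ∀ z, z.1 ∈ A → g z = k then
        ∑ d : K, if d ≠ g ⟨w, hwx⟩ ∧ (x ∈ A → d = k) then (1 : ℚ) else 0 else 0 := by
  unfold fixedColorings
  rw [← (Equiv.funSplitAt x K).symm.sum_comp, Fintype.sum_prod_type, Finset.sum_comm]
  refine Finset.sum_congr (by ext; simp) fun g _ => ?_
  have hite (Q : Prop) [Decidable Q] (F : K → ℚ) : (if Q then ∑ d, F d else 0) = ∑ d, if Q then F d else 0 := by
    split_ifs <;> simp
  rw [hite]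
  refine Finset.sum_congr rfl fun d _ => ?_
  rw [← ite_and]
  refine if_congr ?_ rfl rfl
  have h0 : (Equiv.funSplitAt x K).symm (d, g) x = d := by simp
  have h1 (z : {z // z ≠ x}) : (Equiv.funSplitAt x K).symm (d, g) z.1 = g z := by simp [z.2]
  constructor
  · rintro ⟨hf, hA⟩
    refine ⟨⟨fun a b hab => ?_, fun z hz => ?_⟩, ?_, fun hx => ?_⟩
    · rw [← h1, ← h1]
      exact hf _ _ hab
    · rw [← h1]
      exact hA _ hz
    · have := hf x w ((hw w).2 rfl)
      rwa [h0, h1 ⟨w, hwx⟩] at this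
    · rw [← h0]
      exact hA _ hx
  · rintro ⟨⟨hf, hA⟩, hd, hx⟩
    refine ⟨fun a b hab => ?_, fun z hz => ?_⟩
    · by_cases ha : a = x
      · subst ha
        obtain rfl := (hw b).1 hab
        rw [h0, h1 ⟨b, hwx⟩]
        exact hd
      · by_cases hb : b = x
        · subst hb
          obtain rfl := (hw a).1 hab.symm
          rw [h0, h1 ⟨a, hwx⟩]
          exact hd.symm
        · rw [h1 ⟨a, ha⟩, h1 ⟨b, hb⟩]
          exact hf ⟨a, ha⟩ ⟨b, hb⟩ hab
    · by_cases h : z = x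
      · subst h
        rw [h0]
        exact hx hz
      · rw [h1 ⟨z, h⟩]
        exact hA ⟨z, h⟩ hz

theorem fixedColorings_of_notMem [DecidableEq V] (hw : ∀ z, T.Adj x z ↔ z = w) (hA : x ∉ A) :
    fixedColorings T k A = (Fintype.card K - 1) *
      fixedColorings (removeVertex T x) k (Subtype.val ⁻¹' A) := by
  classical
  have hwx : w ≠ x := ((hw w).2 rfl).ne'
  rw [fixedColorings_eq_sum_removeVertex hw hwx, fixedColorings, Finset.mul_sum]
  refine Finset.sum_congr (by ext; simp) fun g _ => ?_
  have : (∑ d : K, if d ≠ g ⟨w, hwx⟩ ∧ (x ∈ A → d = k) then (1 : ℚ) else 0) =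
      Fintype.card K - 1 := by
    simp only [hA, false_implies, and_true]
    rw [← Finset.sum_filter, Finset.filter_ne', Finset.sum_const, nsmul_one,
      Finset.card_erase_of_mem (Finset.mem_univ _), Finset.card_univ,
      Nat.cast_sub (Fintype.card_pos_iff.2 ⟨k⟩), Nat.cast_one]
  rw [this, mul_ite, mul_one, mul_zero]
  congr!

/-- Once the leaf `x` has colour `k`, it only forbids `k` at its neighbour `w`. -/
theorem fixedColorings_of_mem [DecidableEq V] (hw : ∀ z, T.Adj x z ↔ z = w) (hwx : w ≠ x)
    (hA : x ∈ A) : fixedColorings T k A =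
      fixedColorings (removeVertex T x) k (Subtype.val ⁻¹' A) -
      fixedColorings (removeVertex T x) k (insert ⟨w, hwx⟩ (Subtype.val ⁻¹' A)) := by
  classical
  rw [fixedColorings_eq_sum_removeVertex hw hwx, fixedColorings, fixedColorings,
    ← Finset.sum_sub_distrib]
  refine Finset.sum_congr (by ext; simp) fun g _ => ?_
  have : (∑ d : K, if d ≠ g ⟨w, hwx⟩ ∧ (x ∈ A → d = k) then (1 : ℚ) else 0) =
      1 - if g ⟨w, hwx⟩ = k then 1 else 0 := by
    rw [Fintype.sum_eq_single k]
    · by_cases h : g ⟨w, hwx⟩ = k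
      · simp [h]
      · simp [h, Ne.symm h]
    · intro d hd
      exact if_neg fun h => hd (h.2 hA)
  rw [this]
  simp only [Set.forall_mem_insert, Set.mem_preimage]
  by_cases h1 : g ⟨w, hwx⟩ = k
  · simp [h1]
  · simp [h1]

end Leaf

/-- The probability that two vertices at distance `d` in a tree have the same colour in a random
proper colouring with `M + 1` colours. -/
noncomputable def returnProb (M : ℚ) (d : ℕ) : ℚ := (1 + M * (-1 / M) ^ d) / (M + 1)

theorem returnProb_zero {M : ℚ} (hM : 0 < M) : returnProb M 0 = 1 := by
  unfold returnProb
  have : M + 1 ≠ 0 := by positivity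
  field_simp
  ring

theorem returnProb_succ {M : ℚ} (hM : 0 < M) (d : ℕ) :
    M * returnProb M (d + 1) = 1 - returnProb M d := by
  unfold returnProb
  have : M + 1 ≠ 0 := by positivity
  rw [pow_succ]
  field_simp
  ring

/-- Induction by removing a leaf `x` with neighbour `w`. If `x` is not prescribed, it has `M`
possible colours. If it is, inclusion–exclusion at `w` reproduces the recursion `returnProb_succ`,
as distances from `x` are one more than those from `w`. -/
theorem fixedColorings_tree {K : Type*} [Fintype K] (k : K) {M : ℚ} (hM : 0 < M)
    (hK : (Fintype.card K : ℚ) = M + 1) {V : Type*} [Fintype V] {T : SimpleGraph V}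
    (hT : T.IsTree) :
    fixedColorings T k ∅ = (M + 1) * M ^ (Fintype.card V - 1) ∧ ∀ u v,
      fixedColorings T k {u, v} = M ^ (Fintype.card V - 1) * returnProb M (T.dist u v) := by
  classical
  have hK' : (Fintype.card K - 1 : ℚ) = M := by rw [hK]; ring
  induction hn : Fintype.card V using Nat.strong_induction_on generalizing V with
  | _ n ih =>
  have hne : Nonempty V := hT.connected.nonempty
  rcases subsingleton_or_nontrivial V with hV | hV
  · have hn1 : n = 1 := by
      rw [← hn]
      exact Fintype.card_eq_one_iff.2 ⟨hne.some, fun _ => Subsingleton.elim _ _⟩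
    subst hn1
    have hTadj (a b : V) : ¬ T.Adj a b := fun h => h.ne (Subsingleton.elim a b)
    have : Inhabited V := ⟨hne.some⟩
    have := Unique.mk' V
    constructor
    · simp [fixedColorings, hTadj, hK]
    · intro u v
      obtain rfl := Subsingleton.elim u v
      rw [SimpleGraph.dist_self, returnProb_zero hM, fixedColorings,
        Finset.sum_eq_single fun _ => k]
      · simp [hTadj]
      · intro f _ hf
        refine if_neg fun h => hf ?_
        funext z
        obtain rfl := Subsingleton.elim u z
        exact h.2 u (by simp)
      · simp
  · obtain ⟨x, hx⟩ := hT.exists_vert_degree_one_of_nontrivial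
    obtain ⟨w, hxw, hw⟩ := SimpleGraph.degree_eq_one_iff_existsUnique_adj.1 hx
    have hw' (z : V) : T.Adj x z ↔ z = w := ⟨hw z, fun h => h ▸ hxw⟩
    have hwx : w ≠ x := hxw.ne'
    have hT' := isTree_removeVertex hT hw'
    have hcard : Fintype.card {z // z ≠ x} = n - 1 := by
      rw [Fintype.card_subtype_compl, Fintype.card_subtype_eq, hn]
    have hn2 : 2 ≤ n := hn ▸ Fintype.one_lt_card
    obtain ⟨m, rfl⟩ : ∃ m, n = m + 2 := ⟨n - 2, by omega⟩
    obtain ⟨ih0, ih2⟩ := ih (m + 1) (by omega) hT' hcard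
    simp only [Nat.add_sub_cancel, show m + 2 - 1 = m + 1 from rfl, dist_removeVertex hT hT']
      at ih0 ih2 ⊢
    have ih1 (u : {z // z ≠ x}) : fixedColorings (removeVertex T x) k {u} = M ^ m := by
      have := ih2 u u
      rwa [SimpleGraph.dist_self, returnProb_zero hM, mul_one, Set.pair_eq_singleton] at this
    have hxv (v : V) (hv : v ≠ x) :
        fixedColorings T k {x, v} = M ^ (m + 1) * returnProb M (T.dist x v) := by
      have : (Subtype.val ⁻¹' {x, v} : Set {z // z ≠ x}) = {⟨v, hv⟩} := by
        ext z
        simp [z.2, Subtype.ext_iff]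
      rw [fixedColorings_of_mem hw' hwx (by simp), this, ih1, ih2, dist_leaf hT hT' hxw hv,
        pow_succ, mul_assoc, returnProb_succ hM]
      ring
    refine ⟨?_, fun u v => ?_⟩
    · rw [fixedColorings_of_notMem hw' (Set.notMem_empty x), Set.preimage_empty, ih0, hK']
      ring
    · by_cases hu : u = x
      · subst hu
        by_cases hv : v = u
        · subst hv
          have : (Subtype.val ⁻¹' {v} : Set {z // z ≠ v}) = ∅ := by
            ext z
            simp [z.2]
          rw [Set.pair_eq_singleton, SimpleGraph.dist_self, returnProb_zero hM,
            fixedColorings_of_mem hw' hwx (Set.mem_singleton v), this, ih0, LawfulSingleton.insert_empty_eq, ih1]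
          ring
        · exact hxv v hv
      · by_cases hv : v = x
        · subst hv
          rw [Set.pair_comm, SimpleGraph.dist_comm]
          exact hxv u hu
        · have : (Subtype.val ⁻¹' {u, v} : Set {z // z ≠ x}) = {⟨u, hu⟩, ⟨v, hv⟩} := by
            ext z
            simp [Subtype.ext_iff]
          rw [fixedColorings_of_notMem hw' (by simp [Ne.symm hu, Ne.symm hv]), this, ih2, hK']
          ring

open Polynomial in
-- Both sides sum the squared size of the colour class of `k` over proper colourings: marking `k` by
-- `X` records the size `j` as `X ^ j`, and the operator followed by evaluation at `1` turns this
-- into `j ^ 2`.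
theorem sum_fixedColorings_eq {V K : Type*} [Fintype V] [Fintype K] [DecidableEq K]
    (T : SimpleGraph V) (k : K) : ∑ u, ∑ v, fixedColorings T k {u, v} =
      (derivative (X * derivative (colorSum T fun i => if i = k then (X : ℚ[X]) else 1))).eval 1 := by
  classical
  have hX (f : V → K) : ∏ v, (if f v = k then (X : ℚ[X]) else 1) =
      X ^ (Finset.univ.filter fun v => f v = k).card := by
    rw [Finset.prod_ite, Finset.prod_const_one, Finset.prod_const, mul_one]
  have hL (j : ℕ) : (derivative (X * derivative (X ^ j : ℚ[X]))).eval 1 = (j : ℚ) * j := by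
    rcases j with _ | j
    · simp
    · simp [derivative_X_pow]
      ring
  unfold colorSum weightedColorings fixedColorings
  simp only [hX, map_sum, Finset.mul_sum, eval_finsetSum]
  rw [Finset.sum_congr rfl fun u _ => Finset.sum_comm, Finset.sum_comm]
  refine Finset.sum_congr rfl fun f _ => ?_
  by_cases hf : ∀ a b, T.Adj a b → f a ≠ f b
  · rw [if_pos hf, hL, Finset.card_filter]
    push_cast
    rw [Finset.sum_mul_sum]
    refine Finset.sum_congr rfl fun u _ => Finset.sum_congr rfl fun v _ => ?_
    by_cases h1 : f u = k <;> by_cases h2 : f v = k <;> simp [h1, h2]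
    · exact hf
  · rw [if_neg hf]
    simp [hf]

open Polynomial in
theorem distPolynomial_eq_of_chromSym_eq {V W : Type*} [Fintype V] [Fintype W] {T : SimpleGraph V}
    {T' : SimpleGraph W} (hT : T.IsTree) (hT' : T'.IsTree) (h : chromSym T = chromSym T') :
    ∑ u, ∑ v, (X : ℚ[X]) ^ T.dist u v = ∑ u, ∑ v, (X : ℚ[X]) ^ T'.dist u v := by
  have hcard := card_eq_of_chromSym_eq h
  -- With `M + 2` colours the second moment is affine in this sum, with coefficients that depend
  -- only on `M` and the order of the tree. The points `-1 / (M + 1)` are infinitely many.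
  have key (M : ℕ) : ∑ u, ∑ v, (-1 / (M + 1 : ℚ)) ^ T.dist u v =
      ∑ u, ∑ v, (-1 / (M + 1 : ℚ)) ^ T'.dist u v := by
    have hM : (0 : ℚ) < M + 1 := by positivity
    have hK : (Fintype.card (Fin (M + 2)) : ℚ) = (M + 1) + 1 := by
      rw [Fintype.card_fin]
      push_cast
      ring
    have h1 := sum_fixedColorings_eq T (0 : Fin (M + 2))
    rw [colorSum_eq_of_chromSym_eq h, ← sum_fixedColorings_eq] at h1
    simp only [(fixedColorings_tree (0 : Fin (M + 2)) hM hK hT).2,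
      (fixedColorings_tree (0 : Fin (M + 2)) hM hK hT').2, ← Finset.mul_sum, hcard] at h1
    have h2 := mul_left_cancel₀ (pow_ne_zero _ hM.ne') h1
    simp only [returnProb, ← Finset.sum_div] at h2
    have h3 := (div_left_inj' (by positivity)).1 h2
    simp only [Finset.sum_add_distrib, ← Finset.mul_sum, Finset.sum_const, Finset.card_univ,
      hcard] at h3
    exact mul_left_cancel₀ hM.ne' (add_left_cancel h3)
  refine Polynomial.eq_of_infinite_eval_eq _ _ (Set.infinite_of_injective_forall_mem
    (f := fun M : ℕ => (-1 / (M + 1 : ℚ))) ?_ fun M => ?_)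
  · intro a b hab
    have ha : (a + 1 : ℚ) ≠ 0 := by positivity
    have hb : (b + 1 : ℚ) ≠ 0 := by positivity
    simp only [div_eq_div_iff ha hb] at hab
    have : (a : ℚ) = b := by linarith
    exact_mod_cast this
  · simpa [eval_finsetSum] using key M

open Polynomial in
theorem exists_dist_eq_of_chromSym_eq {V W : Type*} [Fintype V] [Fintype W] {T : SimpleGraph V}
    {T' : SimpleGraph W} (hT : T.IsTree) (hT' : T'.IsTree) (h : chromSym T = chromSym T')
    (u v : V) : ∃ u' v', T'.dist u' v' = T.dist u v := by
  by_contra! hne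
  have := congrArg (fun P => coeff P (T.dist u v)) (distPolynomial_eq_of_chromSym_eq hT hT' h)
  simp only [finsetSum_coeff, coeff_X_pow, (hne _ _).symm, if_false, Finset.sum_const_zero] at this
  have hpos : (0 : ℚ) < ∑ a, ∑ b, if T.dist u v = T.dist a b then 1 else 0 := by
    refine Finset.sum_pos' (fun a _ => Finset.sum_nonneg fun b _ => ?_) ⟨u, Finset.mem_univ u,
      Finset.sum_pos' (fun b _ => ?_) ⟨v, Finset.mem_univ v, by simp⟩⟩ <;> split_ifs <;> simp
  exact hpos.ne' this

theorem diam_le_of_chromSym_eq {V W : Type*} [Fintype V] [Fintype W] {T : SimpleGraph V}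
    {T' : SimpleGraph W} (hT : T.IsTree) (hT' : T'.IsTree) (h : chromSym T = chromSym T') :
    T.diam ≤ T'.diam := by
  have : Nonempty V := hT.connected.nonempty
  have : Nonempty W := hT'.connected.nonempty
  obtain ⟨u, v, huv⟩ := T.exists_dist_eq_diam
  obtain ⟨u', v', h'⟩ := exists_dist_eq_of_chromSym_eq hT hT' h u v
  rw [← huv, ← h']
  exact SimpleGraph.dist_le_diam (SimpleGraph.connected_iff_ediam_ne_top.1 hT'.connected)

theorem diam_eq_of_chromSym_eq {V W : Type*} [Fintype V] [Fintype W] {T : SimpleGraph V}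
    {T' : SimpleGraph W} (hT : T.IsTree) (hT' : T'.IsTree) (h : chromSym T = chromSym T') :
    T.diam = T'.diam :=
  (diam_le_of_chromSym_eq hT hT' h).antisymm (diam_le_of_chromSym_eq hT' hT h.symm)

/-! ### Reconstruction and the main theorem -/

theorem partList_injective {n : ℕ} {lam mu : n.Partition} (h : partList lam = partList mu) :
    lam = mu := by
  refine Nat.Partition.ext ?_
  rw [← partList_coe, ← partList_coe, h]

theorem IsLeadingPartition.unique {n : ℕ} {c : n.Partition → ℚ} {lam mu : n.Partition}
    (h : IsLeadingPartition c lam) (h' : IsLeadingPartition c mu) : lam = mu :=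
  partList_injective (le_antisymm (h.2 mu h'.1) (h'.2 lam h.1))

/-- The algorithm reconstructs a tree of diameter four from its star expansion. -/
theorem exists_starExpansion_reconstructTree {V : Type*} [Fintype V] {n : ℕ}
    (hn : Fintype.card V = n) {T : SimpleGraph V} (hT : T.IsTree) (hd : T.diam = 4) :
    ∃ c : n.Partition → ℚ, IsStarExpansion T c ∧ ∃ lam : n.Partition, IsLeadingPartition c lam ∧
      Nonempty (reconstructTree lam (fun mu => c mu.1) ≃g T) := by
  obtain ⟨p, s, hp, hs, hcard, hiso⟩ := hT.exists_iso_joinedStars hd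
  have hsort : ((s.sort (· ≥ ·) : List ℕ) : Multiset ℕ) = s := Multiset.sort_eq _ _
  generalize s.sort (· ≥ ·) = l at hsort
  obtain ⟨e⟩ := hiso l hsort
  have hl (m) (hm : m ∈ l) : 2 ≤ m := hs m (by rw [← hsort]; exact hm)
  have hl' (m) (hm : m ∈ l) : 0 < m := by have := hl m hm; omega
  have hsum : p + l.sum = n := by
    rw [← hn, Fintype.card_congr e.toEquiv, Fintype.card_sigma]
    simp only [Fintype.card_fin]
    have : ∑ i, (p :: l).get i = (p :: l).sum := Fin.sum_univ_getElem _
    rw [this, List.sum_cons]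
  let lam : n.Partition := ⟨p ::ₘ s, fun {m} hm => by
    rcases Multiset.mem_cons.1 hm with rfl | hm
    · exact hp
    · have := hs m hm
      omega, by rw [Multiset.sum_cons, ← hsort, Multiset.sum_coe, hsum]⟩
  have hlam : lam.parts = p ::ₘ Finset.univ.val.map l.get := by
    change p ::ₘ s = _
    rw [← hsort]
    simp
  have hq (i : Fin l.length) : 2 ≤ l.get i := hl _ (l.get_mem i)
  have hι : 2 ≤ Fintype.card (Fin l.length) := by
    rwa [Fintype.card_fin, ← Multiset.coe_card, hsort]
  refine ⟨joinCoeff p l.get, isStarExpansion_joinCoeff e hp hl' hsum, lam,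
    isLeadingPartition_joinCoeff hp hq hι hlam, ?_⟩
  unfold reconstructTree starOrders
  rw [centralOrder_joinCoeff hp hq hι hlam]
  obtain ⟨e'⟩ := hiso ((partList lam).erase p) (by
    rw [← Multiset.coe_erase, partList_coe]
    exact Multiset.erase_cons_head _ _)
  exact ⟨e'.symm⟩

/-- Let `T` be a tree of order `n` and diameter four. Then `T` is determined, up to isomorphism and
among all trees, by its chromatic symmetric function. This function has a unique expansion
in the star basis, and `T` is determined, up to isomorphism and among the trees of diameter four,
by the leading partition `lam` and the coefficients indexed by the partitions without parts `1` and
of length one less than that of `lam`: the explicit algorithm `reconstructTree` finds `T` from these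
data. -/
theorem mainTheorem3 {V : Type*} [Fintype V] (n : ℕ) (hn : Fintype.card V = n)
    (T : SimpleGraph V) (hT : T.IsTree) (hdiam : T.diam = 4) :
    (∀ {W : Type*} [Fintype W] (T' : SimpleGraph W), T'.IsTree → chromSym T' = chromSym T →
      Nonempty (T' ≃g T)) ∧
    (∃! c : n.Partition → ℚ, IsStarExpansion T c) ∧
    (∀ c : n.Partition → ℚ, IsStarExpansion T c →
      ∃ lam : n.Partition, IsLeadingPartition c lam ∧
        Nonempty (reconstructTree lam (fun mu => c mu.1) ≃g T)) ∧
    (∀ {W : Type*} [Fintype W] (T' : SimpleGraph W), T'.IsTree → T'.diam = 4 →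
      ∀ (c c' : n.Partition → ℚ) (lam : n.Partition),
        IsStarExpansion T c → IsStarExpansion T' c' →
        IsLeadingPartition c lam → IsLeadingPartition c' lam →
        (∀ mu : MergeIndex lam, c mu.1 = c' mu.1) → Nonempty (T' ≃g T)) := by
  obtain ⟨c₀, hc₀, lam₀, hlam₀, ⟨e₀⟩⟩ := exists_starExpansion_reconstructTree hn hT hdiam
  refine ⟨fun T' hT' h => ?_, ⟨c₀, hc₀, fun c hc => hc.unique hc₀⟩, fun c hc => ?_,
    fun T' hT' hdiam' c c' lam hc hc' hlam hlam' hcc' => ?_⟩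
  · obtain ⟨c, hc, lam, hlam, ⟨e⟩⟩ := exists_starExpansion_reconstructTree
      ((card_eq_of_chromSym_eq h).trans hn) hT' ((diam_eq_of_chromSym_eq hT' hT h).trans hdiam)
    have hc' : IsStarExpansion T c := h.symm.trans hc
    obtain rfl := hc'.unique hc₀
    obtain rfl := hlam.unique hlam₀
    exact ⟨e.symm.trans e₀⟩
  · obtain rfl := hc.unique hc₀
    exact ⟨lam₀, hlam₀, ⟨e₀⟩⟩
  -- The order of `T'` is not assumed to be `n`. It follows from the existence of an expansion
  -- indexed by partitions of `n`.
  · obtain ⟨c₁, hc₁, lam₁, hlam₁, ⟨e₁⟩⟩ := exists_starExpansion_reconstructTree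
      hc'.card_eq hT' hdiam'
    obtain rfl := hc.unique hc₀
    obtain rfl := hlam.unique hlam₀
    obtain rfl := hc'.unique hc₁
    obtain rfl := hlam'.unique hlam₁
    rw [← funext hcc'] at e₁
    exact ⟨e₁.symm.trans e₀⟩
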